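/- **Theorem (Phase-type approximation).** Terminology. A $d\times d$ real matrix is a sub-intensity matrix if its off-diagonal entries are non-negative and its row sums are non-positive. For a probability vector $\alpha$ on $\{1,\dots,d\}$ and a sub-intensity matrix function $T(\cdot)$, we write $\tau\sim\mathrm{IPH}(\alpha,T(\cdot))$ if $\tau$ is a finite random variable distributed as the time until absorption in state $d+1$ of a (time-inhomogeneous) Markov jump process on $\{1,\dots,d,d+1\}$ with initial distribution $(\alpha,0)$ and intensity matrix $\begin{pmatrix}T(t)&-T(t)e\\0&0\end{pmatrix}$, where $e=(1,\dots,1)'$; if $T(\cdot)\equiv T$ is constant we write $\mathrm{PH}(\alpha,T)$. Let $0=s_0<s_1<\cdots<s_{K-1}<s_K=\infty$, let $T_1,\dots,T_K$ be $p\times p$ sub-intensity matrices, and let $\tau\sim\mathrm{IPH}(\alpha,T(\cdot))$ be defined on a probability space $(\Omega,\mathbb P)$, where $T(s)=T_k$ for $s\in(s_{k-1},s_k]$. For integers $n,m,\ell\ge1$ let $\omega_k(\ell,n)=E(s_k;\ell,n)-E(s_{k-1};\ell,n)$, where $E(\cdot;\ell,n)$ is the Erlang distribution function with $\ell$ stages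 and rate $n$ (and $E(\infty;\ell,n)=1$), and put $$Q^{(n)}_\ell=\sum_{k=1}^K\omega_k(\ell,n)\,T_k/n+I .$$ Let $T^{(n,m)}$ be the $mp\times mp$ matrix with $m\times m$ blocks of size $p\times p$, whose diagonal blocks are $-nI$, whose block in position $(\ell,\ell+1)$ is $nQ^{(n)}_\ell$ for $\ell=1,\dots,m-1$, and whose other blocks are $0$; let $\alpha^{(m)}=(\alpha,0,\dots,0)$. 1. If $n\ge\max_{k,i}|(T_k)_{ii}|$, then $T^{(n,m)}$ is a sub-intensity matrix for every $m\ge1$. 2. There exist random variables $\tau^{(n,m)}$ on $(\Omega,\mathbb P)$ such that, for all $n,m\ge1$ for which $T^{(n,m)}$ is a sub-intensity matrix, $\tau^{(n,m)}\sim\mathrm{PH}(\alpha^{(m)},T^{(n,m)})$ and $\tau^{(n,m)}$ has on $[0,\infty)$ the (non-negative) density $$f_{\tau^{(n,m)}}(t)=\sum_{\ell=1}^{m-1}\Big[\alpha Q^{(n)}_1\cdots Q^{(n)}_{\ell-1}(I-Q^{(n)}_\ell)e\Big]\frac{t^{\ell-1}}{(\ell-1)!}n^\ell e^{-nt}+\Big[\alpha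 Q^{(n)}_1\cdots Q^{(n)}_{m-1}e\Big]\frac{t^{m-1}}{(m-1)!}n^m e^{-nt},$$ and such that for every $\epsilon>0$ $$\lim_{n\to\infty}\lim_{m\to\infty}\mathbb P\big(|\tau-\tau^{(n,m)}|>\epsilon\big)=0,$$ where the inner limit exists for every $n\ge1$ such that $T^{(n,m)}$ is a sub-intensity matrix for all $m\ge1$ (by 1., for all large $n$). -/

import Mathlib

open MeasureTheory ProbabilityTheory Filter Topology
open scoped NNReal ENNReal Matrix Nat

noncomputable section

/-! ### Markov jump processes and (inhomogeneous) phase-type distributions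

Throughout, `ι` is the set of transient states, and `Option ι` the full state space, with `none` the
absorbing state. -/

/-- A sub-intensity matrix: non-negative off-diagonal entries and non-positive row sums. -/
structure IsSubIntensity {ι : Type*} [Fintype ι] (T : Matrix ι ι ℝ) : Prop where
  off_diag_nonneg : ∀ i j, i ≠ j → 0 ≤ T i j
  row_sum_nonpos : ∀ i, ∑ j, T i j ≤ 0

/-- The intensity matrix with block form `[[T, -T e], [0, 0]]`. -/
def fullIntensity {ι : Type*} [Fintype ι] (T : Matrix ι ι ℝ) :
    Matrix (Option ι) (Option ι) ℝ :=
  fun a b => match a, b with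
    | some i, some j => T i j
    | some i, none => -∑ j, T i j
    | none, _ => 0

/-- `p s t`, `0 ≤ s ≤ t`, is the product integral of `Λ` over `(s, t]`, that is, the solution of
`p s t = I + ∫ u in s..t, p s u * Λ u` (the forward Kolmogorov equation). -/
def IsProductIntegral {S : Type*} [Fintype S] [DecidableEq S]
    (Λ : ℝ → Matrix S S ℝ) (p : ℝ → ℝ → Matrix S S ℝ) : Prop :=
  ∀ s t : ℝ, 0 ≤ s → s ≤ t → ∀ i j : S,
    IntervalIntegrable (fun u => (p s u * Λ u) i j) volume s t ∧
    p s t i j = (1 : Matrix S S ℝ) i j + ∫ u in s..t, (p s u * Λ u) i j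

/-- `X` is a (time-inhomogeneous) Markov jump process on the finite state space `S` with initial
distribution `α` and intensity matrix function `Λ`: its paths are right-continuous step functions
with left limits, and it is Markov with the product integral of `Λ` as transition matrices. -/
structure IsMarkovJumpProcess {Ω S : Type*} [MeasurableSpace Ω] [Fintype S] [DecidableEq S]
    (P : Measure Ω) (X : ℝ≥0 → Ω → S) (α : S → ℝ) (Λ : ℝ → Matrix S S ℝ) : Prop where
  measurableSet_eq : ∀ t i, MeasurableSet {ω | X t ω = i}
  right_cont : ∀ ω t, ∀ᶠ u in 𝓝[>] t, X u ω = X t ω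
  left_lim : ∀ ω t, ∃ i, ∀ᶠ u in 𝓝[<] t, X u ω = i
  init : ∀ i, P.real {ω | X 0 ω = i} = α i
  markov : ∃ p : ℝ → ℝ → Matrix S S ℝ, IsProductIntegral Λ p ∧
    ∀ (r : ℕ) (s : Fin (r + 1) → ℝ≥0) (t : ℝ≥0) (i : Fin (r + 1) → S) (j : S),
      Monotone s → s (Fin.last r) ≤ t →
      P.real {ω | (∀ a, X (s a) ω = i a) ∧ X t ω = j} =
        P.real {ω | ∀ a, X (s a) ω = i a} * p (s (Fin.last r)) t (i (Fin.last r)) j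

/-- The time until absorption, `inf {t ≥ 0 | X t = none}` (equal to `∞` if absorption never
occurs). -/
def absorptionTime {Ω ι : Type*} (X : ℝ≥0 → Ω → Option ι) (ω : Ω) : ℝ≥0∞ :=
  ⨅ (t : ℝ≥0) (_ : X t ω = none), (t : ℝ≥0∞)

/-- `τ ∼ IPH(π, T(·))`: the (finite) random variable `τ` has the law of the absorption time of a
Markov jump process on `Option ι` that starts in the transient state `i` with probability `π i` and
has sub-intensity matrix function `T`. -/
structure HasIPH {Ω ι : Type*} [MeasurableSpace Ω] [Fintype ι] [DecidableEq ι]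
    (P : Measure Ω) (τ : Ω → ℝ≥0) (π : ι → ℝ) (T : ℝ → Matrix ι ι ℝ) : Prop where
  init_nonneg : ∀ i, 0 ≤ π i
  init_sum : ∑ i, π i = 1
  subIntensity : ∀ t, 0 < t → IsSubIntensity (T t)
  measurable : Measurable τ
  law : ∃ (Ω' : Type) (_ : MeasurableSpace Ω') (P' : Measure Ω') (_ : IsProbabilityMeasure P')
    (X : ℝ≥0 → Ω' → Option ι),
    IsMarkovJumpProcess P' X (fun a => a.elim 0 π) (fun t => fullIntensity (T t)) ∧
    P.map (fun ω => (τ ω : ℝ≥0∞)) = P'.map (absorptionTime X)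

/-- `τ ∼ PH(π, T)`, the time-homogeneous case. -/
def HasPH {Ω ι : Type*} [MeasurableSpace Ω] [Fintype ι] [DecidableEq ι]
    (P : Measure Ω) (τ : Ω → ℝ≥0) (π : ι → ℝ) (T : Matrix ι ι ℝ) : Prop :=
  HasIPH P τ π (fun _ => T)

/-! ### Piecewise constant sub-intensities and the homogeneous approximation -/

/-- A grid `0 = s₀ < s₁ < ⋯ < s_K = ∞`. -/
structure IsGrid {K : ℕ} (s : Fin (K + 1) → ℝ≥0∞) : Prop where
  strictMono : StrictMono s
  zero : s 0 = 0
  last : s (Fin.last K) = ⊤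

/-- The matrix function equal to `T k` on the `k`-th interval of the grid, which is open on the left
and closed on the right (the value for `u ≤ 0` is immaterial). -/
def piecewiseConst {K p : ℕ} (s : Fin (K + 1) → ℝ≥0∞) (T : Fin K → Matrix (Fin p) (Fin p) ℝ)
    (u : ℝ) : Matrix (Fin p) (Fin p) ℝ :=
  ∑ k : Fin K,
    if s k.castSucc < ENNReal.ofReal u ∧ ENNReal.ofReal u ≤ s k.succ then T k else 0

/-- The Erlang distribution function with `ℓ ≥ 1` stages and rate `n`, on `[0, ∞]`. -/
def erlangCDF (x : ℝ≥0∞) (ℓ n : ℕ) : ℝ :=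
  (gammaMeasure (ℓ : ℝ) (n : ℝ)).real {y | ENNReal.ofReal y ≤ x}

/-- The matrix `Q_ℓ⁽ⁿ⁾ = ∑ₖ ω_k(ℓ, n) T_k / n + I`, with weights
`ω_k(ℓ, n) = E(s_k; ℓ, n) - E(s_{k-1}; ℓ, n)`. -/
def stepMatrix {K p : ℕ} (s : Fin (K + 1) → ℝ≥0∞) (T : Fin K → Matrix (Fin p) (Fin p) ℝ)
    (n ℓ : ℕ) : Matrix (Fin p) (Fin p) ℝ :=
  (∑ k : Fin K, (erlangCDF (s k.succ) ℓ n - erlangCDF (s k.castSucc) ℓ n) •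
    ((n : ℝ)⁻¹ • T k)) + 1

/-- The `mp × mp` block-bidiagonal matrix `T⁽ⁿ'ᵐ⁾`: blocks `-n I` on the diagonal, and `n Q_ℓ⁽ⁿ⁾` in
block position `(ℓ, ℓ + 1)`, `ℓ = 1, …, m - 1`. Block `ℓ` has index `ℓ - 1` in `Fin m`. -/
def approxIntensity {K p : ℕ} (s : Fin (K + 1) → ℝ≥0∞) (T : Fin K → Matrix (Fin p) (Fin p) ℝ)
    (n m : ℕ) : Matrix (Fin m × Fin p) (Fin m × Fin p) ℝ :=
  fun x y =>
    if y.1 = x.1 then -(n : ℝ) * (1 : Matrix (Fin p) (Fin p) ℝ) x.2 y.2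
    else if (y.1 : ℕ) = x.1 + 1 then (n : ℝ) * stepMatrix s T n (x.1 + 1) x.2 y.2
    else 0

/-- The initial vector `(α, 0, …, 0)` with `m` blocks. -/
def approxInit {p : ℕ} (α : Fin p → ℝ) (m : ℕ) : Fin m × Fin p → ℝ :=
  fun x => if (x.1 : ℕ) = 0 then α x.2 else 0

/-- The row vector `α Q_1⁽ⁿ⁾ ⋯ Q_r⁽ⁿ⁾`. -/
def stepRow {K p : ℕ} (s : Fin (K + 1) → ℝ≥0∞) (T : Fin K → Matrix (Fin p) (Fin p) ℝ)
    (α : Fin p → ℝ) (n r : ℕ) : Fin p → ℝ :=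
  α ᵥ* ((List.range r).map fun ℓ => stepMatrix s T n (ℓ + 1)).prod

/-- The Erlang-mixture density of the approximation, on `[0, ∞)`. -/
def approxDensity {K p : ℕ} (s : Fin (K + 1) → ℝ≥0∞) (T : Fin K → Matrix (Fin p) (Fin p) ℝ)
    (α : Fin p → ℝ) (n m : ℕ) (t : ℝ) : ℝ :=
  (∑ ℓ ∈ Finset.Icc 1 (m - 1),
    (stepRow s T α n (ℓ - 1) ⬝ᵥ ((1 - stepMatrix s T n ℓ) *ᵥ (fun _ => (1 : ℝ)))) *
      (t ^ (ℓ - 1) / ((ℓ - 1)! : ℝ)) * (n : ℝ) ^ ℓ * Real.exp (-(n : ℝ) * t)) +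
  (stepRow s T α n (m - 1) ⬝ᵥ (fun _ => (1 : ℝ))) *
    (t ^ (m - 1) / ((m - 1)! : ℝ)) * (n : ℝ) ^ m * Real.exp (-(n : ℝ) * t)

/-- The non-negative random variable `Y` has density `f` on `[0, ∞)`. -/
def HasDensityOnNonneg {Ω : Type*} [MeasurableSpace Ω] (P : Measure Ω) (Y : Ω → ℝ≥0)
    (f : ℝ → ℝ) : Prop :=
  (∀ t, 0 ≤ t → 0 ≤ f t) ∧
  P.map (fun ω => (Y ω : ℝ)) =
    (volume.restrict (Set.Ici 0)).withDensity (fun t => ENNReal.ofReal (f t))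

end

/-! ### Linear integral equations -/

/-! The survival function of an absorption time is the total mass of the solution of the forward
equation `v' = v T(t)` (`IsMarkovJumpProcess.absorptionTime_law`), and for bounded intensities
Grönwall makes this solution unique. For the approximation it is explicit
(`isForwardSolution_approxRow`): all diagonal entries of the intensity equal `-n`, so the process
climbs the blocks at the ticks of a rate `n` Poisson clock, and its survival function is `∑_{ℓ<m} (α
Q₁ ⋯ Q_ℓ e) · Poisson(nt){ℓ}`. The density is minus the derivative of this sum.

Average `α Q₁ ⋯ Q_ℓ` over `ℓ ∼ Poisson(nt)`. Because `n (Q_{ℓ+1} - I) = ∑ₖ ω_k(ℓ+1, n) T_k`, the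
average solves `w' = w T(t)` except that `E(s_k; ℓ+1, n)` stands in place of the indicator of `t ≤
s_k`. An Erlang variable with `ℓ+1` stages, `ℓ` being Poisson, has mean square distance `2(nt+1)/n²`
from `t`; Chebyshev and dominated convergence make the resulting defect vanish as `n → ∞`. Keeping
only finitely many levels adds an error that vanishes as `m → ∞` with `n` fixed. Grönwall turns both
defects into a bound on the survival functions (`abs_approxSurvival_sub_le`).

Closeness in law becomes closeness in probability through a quantile coupling. The distribution
function `F` of `τ` is continuous, so `F(τ)` is uniform and the quantile function of the
approximation applied to `F(τ)` has the required law on the given space. The coupled variables lie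
on different sides of `x` with probability at most `|G x - F x|`, and two variables more than `ε`
apart are separated by a point of the grid `εℕ` (`real_quantile_dist_lt_le`). For fixed `n` the
survival functions grow with `m`, hence so do the coupled variables, which yields the inner limit.

The phase-type law also requires a Markov jump process to exist. The chain makes at most `m` jumps,
so one is built by finite induction, prepending one exponential holding time at each stage
(`exists_isMarkovJumpProcess`). -/

lemma le_mul_exp_of_le_add_integral_of_continuous {y : ℝ → ℝ} {a b δ C : ℝ} (hC : 0 ≤ C)
    (hy : Continuous y) (hab : a ≤ b) (h : ∀ t ∈ Set.Icc a b, y t ≤ δ + C * ∫ u in a..t, y u) :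
    y b ≤ δ * Real.exp (C * (b - a)) := by
  -- The upper bound for `y`, damped by the exponential; the hypothesis says exactly that its
  -- derivative is nonpositive.
  have hd : ∀ t, HasDerivAt (fun t => (δ + C * ∫ u in a..t, y u) * Real.exp (-(C * (t - a))))
      (C * y t * Real.exp (-(C * (t - a))) +
        (δ + C * ∫ u in a..t, y u) * (Real.exp (-(C * (t - a))) * -(C * 1))) t := by
    intro t
    have h1 := ((intervalIntegral.integral_hasDerivAt_right (hy.intervalIntegrable a t)
      hy.stronglyMeasurable.stronglyMeasurableAtFilter hy.continuousAt).const_mul C).const_add δ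
    have h2 := ((((hasDerivAt_id t).sub_const a).const_mul C).neg).exp
    exact h1.mul h2
  have hanti : AntitoneOn (fun t => (δ + C * ∫ u in a..t, y u) * Real.exp (-(C * (t - a))))
      (Set.Icc a b) := by
    refine antitoneOn_of_hasDerivWithinAt_nonpos (convex_Icc a b)
      (fun t _ => (hd t).continuousAt.continuousWithinAt) (fun t _ => (hd t).hasDerivWithinAt) ?_
    intro t ht
    have h1 := h t (interior_subset ht)
    have h2 := Real.exp_pos (-(C * (t - a)))
    have h3 : 0 ≤ C * Real.exp (-(C * (t - a))) * ((δ + C * ∫ u in a..t, y u) - y t) :=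
      mul_nonneg (by positivity) (sub_nonneg.2 h1)
    nlinarith
  have h1 := hanti (Set.left_mem_Icc.2 hab) (Set.right_mem_Icc.2 hab) hab
  simp only [intervalIntegral.integral_same, mul_zero, add_zero, sub_self, neg_zero, Real.exp_zero,
    mul_one] at h1
  rw [Real.exp_neg, ← div_eq_mul_inv, div_le_iff₀ (Real.exp_pos _)] at h1
  exact (h b (Set.right_mem_Icc.2 hab)).trans h1

/-- Grönwall's inequality in integral form. -/
lemma le_mul_exp_of_le_add_integral {y : ℝ → ℝ} {a b δ C : ℝ} (hC : 0 ≤ C) (hab : a ≤ b)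
    (hy : ContinuousOn y (Set.Icc a b))
    (h : ∀ t ∈ Set.Icc a b, y t ≤ δ + C * ∫ u in a..t, y u) :
    y b ≤ δ * Real.exp (C * (b - a)) := by
  have he : ∀ t ∈ Set.Icc a b, Set.IccExtend hab ((Set.Icc a b).domRestrict y) t = y t :=
    fun t ht => Set.IccExtend_of_mem hab _ ht
  rw [← he b (Set.right_mem_Icc.2 hab)]
  refine le_mul_exp_of_le_add_integral_of_continuous hC hy.domRestrict.Icc_extend' hab ?_
  intro t ht
  rw [he t ht, intervalIntegral.integral_congr (g := y)]
  · exact h t ht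
  · intro u hu
    rw [Set.uIcc_of_le ht.1] at hu
    exact he u ⟨hu.1, hu.2.trans ht.2⟩

lemma sum_abs_vecMul_le {ι : Type*} [Fintype ι] {M : Matrix ι ι ℝ} {C : ℝ}
    (hM : ∀ i j, |M i j| ≤ C) (z : ι → ℝ) :
    ∑ j, |(z ᵥ* M) j| ≤ Fintype.card ι * C * ∑ i, |z i| := by
  have : ∀ j, |(z ᵥ* M) j| ≤ C * ∑ i, |z i| := fun j => by
    rw [Matrix.vecMul, dotProduct, Finset.mul_sum]
    refine (Finset.abs_sum_le_sum_abs _ _).trans (Finset.sum_le_sum fun i _ => ?_)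
    rw [abs_mul, mul_comm]
    exact mul_le_mul_of_nonneg_right (hM i j) (abs_nonneg _)
  refine (Finset.sum_le_sum fun j _ => this j).trans ?_
  simp [mul_assoc]

/-- Grönwall for the `ℓ¹` norm of `z`. With `e = 0` it gives uniqueness; with `e` an accumulated
defect it gives stability. -/
lemma sum_abs_le_of_eq_add_integral {ι : Type*} [Fintype ι] {Λ : ℝ → Matrix ι ι ℝ} {C : ℝ}
    (hC : 0 ≤ C) (hΛ : ∀ u i j, |Λ u i j| ≤ C) {z e : ℝ → ι → ℝ} {a b δ : ℝ} (hab : a ≤ b)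
    (hz : ∀ j, ContinuousOn (fun t => z t j) (Set.Icc a b))
    (heq : ∀ t ∈ Set.Icc a b, ∀ j, z t j = e t j + ∫ u in a..t, (z u ᵥ* Λ u) j)
    (hint : ∀ j, IntervalIntegrable (fun u => (z u ᵥ* Λ u) j) volume a b)
    (he : ∀ t ∈ Set.Icc a b, ∑ j, |e t j| ≤ δ) :
    ∑ j, |z b j| ≤ δ * Real.exp (Fintype.card ι * C * (b - a)) := by
  have hc : ContinuousOn (fun t => ∑ j, |z t j|) (Set.Icc a b) :=
    continuousOn_finsetSum _ fun j _ => (hz j).abs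
  refine le_mul_exp_of_le_add_integral (y := fun t => ∑ j, |z t j|) (by positivity) hab hc ?_
  intro t ht
  have hsub : Set.uIcc a t ⊆ Set.uIcc a b := by
    rw [Set.uIcc_of_le ht.1, Set.uIcc_of_le hab]
    exact Set.Icc_subset_Icc_right ht.2
  have hint' := fun j => (hint j).mono_set hsub
  calc ∑ j, |z t j| ≤ ∑ j, (|e t j| + ∫ u in a..t, |(z u ᵥ* Λ u) j|) := by
        refine Finset.sum_le_sum fun j _ => ?_
        rw [heq t ht j]
        exact (abs_add_le _ _).trans (add_le_add_right
          (intervalIntegral.abs_integral_le_integral_abs ht.1) _)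
    _ = ∑ j, |e t j| + ∫ u in a..t, ∑ j, |(z u ᵥ* Λ u) j| := by
        rw [Finset.sum_add_distrib, intervalIntegral.integral_finsetSum]
        exact fun j _ => (hint' j).abs
    _ ≤ δ + ∫ u in a..t, Fintype.card ι * C * ∑ i, |z u i| := by
        refine add_le_add (he t ht) (intervalIntegral.integral_mono_on ht.1 ?_ ?_ fun u _ =>
          sum_abs_vecMul_le (hΛ u) (z u))
        · simpa only [Finset.sum_fn] using IntervalIntegrable.sum Finset.univ fun j _ => (hint' j).abs
        · refine (ContinuousOn.intervalIntegrable ?_).const_mul _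
          rw [Set.uIcc_of_le ht.1]
          exact hc.mono (Set.Icc_subset_Icc_right ht.2)
    _ = _ := by rw [intervalIntegral.integral_const_mul]

/-- `v` solves the forward equation `v t = α + ∫ u in 0..t, v u * T u`. -/
def IsForwardSolution {ι : Type*} [Fintype ι] (T : ℝ → Matrix ι ι ℝ) (α : ι → ℝ)
    (v : ℝ → ι → ℝ) : Prop :=
  ∀ t, 0 ≤ t → ∀ i, IntervalIntegrable (fun u => (v u ᵥ* T u) i) volume 0 t ∧
    v t i = α i + ∫ u in 0..t, (v u ᵥ* T u) i

lemma continuousOn_of_eq_add_integral {f g : ℝ → ℝ} {a b c : ℝ} (hab : a ≤ b)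
    (hg : IntervalIntegrable g volume a b)
    (h : ∀ t ∈ Set.Icc a b, f t = c + ∫ u in a..t, g u) : ContinuousOn f (Set.Icc a b) := by
  have h1 := intervalIntegral.continuousOn_primitive_interval' hg Set.left_mem_uIcc
  rw [Set.uIcc_of_le hab] at h1
  exact (continuousOn_const.add h1).congr h

lemma IsForwardSolution.continuousOn {ι : Type*} [Fintype ι] {T : ℝ → Matrix ι ι ℝ} {α : ι → ℝ}
    {v : ℝ → ι → ℝ} (h : IsForwardSolution T α v) {b : ℝ} (hb : 0 ≤ b) (i : ι) :
    ContinuousOn (fun t => v t i) (Set.Icc 0 b) :=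
  continuousOn_of_eq_add_integral hb (h b hb i).1 fun t ht => (h t ht.1 i).2

lemma IsForwardSolution.eq {ι : Type*} [Fintype ι] {T : ℝ → Matrix ι ι ℝ} {C : ℝ}
    (hC : 0 ≤ C) (hT : ∀ u i j, |T u i j| ≤ C) {α : ι → ℝ} {v w : ℝ → ι → ℝ}
    (hv : IsForwardSolution T α v) (hw : IsForwardSolution T α w) {t : ℝ} (ht : 0 ≤ t) :
    v t = w t := by
  have hint : ∀ j, IntervalIntegrable (fun u => ((v u - w u) ᵥ* T u) j) volume 0 t := fun j => by
    simp_rw [Matrix.sub_vecMul, Pi.sub_apply]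
    exact (hv t ht j).1.sub (hw t ht j).1
  have h := sum_abs_le_of_eq_add_integral (z := fun u => v u - w u) (e := fun _ _ => 0) (δ := 0)
    hC hT ht (fun j => (hv.continuousOn ht j).sub (hw.continuousOn ht j)) ?_ hint (by simp)
  · rw [zero_mul] at h
    have h0 := (Finset.sum_eq_zero_iff_of_nonneg fun j _ => abs_nonneg _).1
      (le_antisymm h (Finset.sum_nonneg fun j _ => abs_nonneg _))
    funext j
    simpa [sub_eq_zero] using h0 j (Finset.mem_univ j)
  · intro u hu j
    simp_rw [Matrix.sub_vecMul, Pi.sub_apply]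
    rw [intervalIntegral.integral_sub (hv u hu.1 j).1 (hw u hu.1 j).1, (hv u hu.1 j).2,
      (hw u hu.1 j).2]
    ring

/-! ### The law of the time until absorption -/

section

variable {ι : Type*} [Fintype ι] [DecidableEq ι]

omit [DecidableEq ι] in
lemma mul_fullIntensity_some (M : Matrix (Option ι) (Option ι) ℝ) (T : Matrix ι ι ℝ)
    (a : Option ι) (i : ι) :
    (M * fullIntensity T) a (some i) = ((fun k => M a (some k)) ᵥ* T) i := by
  simp [Matrix.mul_apply, fullIntensity, Fintype.sum_option, Matrix.vecMul, dotProduct]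

/-- The generator has a zero row at `none`, but the forward equation multiplies by it on the right
and does not use that row directly. Instead, the transient entries of row `none` of `p` solve a
homogeneous equation started from zero. -/
lemma IsProductIntegral.absorbing {T : ℝ → Matrix ι ι ℝ} {C : ℝ} (hC : 0 ≤ C)
    (hT : ∀ u i j, |T u i j| ≤ C) {p : ℝ → ℝ → Matrix (Option ι) (Option ι) ℝ}
    (hp : IsProductIntegral (fun t => fullIntensity (T t)) p) {s t : ℝ} (hs : 0 ≤ s)
    (hst : s ≤ t) (i : ι) : p s t none (some i) = 0 := by
  have hint : ∀ j, IntervalIntegrable (fun u => ((fun k => p s u none (some k)) ᵥ* T u) j)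
      volume s t := fun j => by
    simpa only [mul_fullIntensity_some] using (hp s t hs hst none (some j)).1
  have heq : ∀ u ∈ Set.Icc s t, ∀ j, p s u none (some j) =
      0 + ∫ u' in s..u, ((fun k => p s u' none (some k)) ᵥ* T u') j := fun u hu j => by
    simpa [mul_fullIntensity_some] using (hp s u hs hu.1 none (some j)).2
  have h := sum_abs_le_of_eq_add_integral (z := fun u k => p s u none (some k))
    (e := fun _ _ => 0) (δ := 0) hC hT hst
    (fun j => continuousOn_of_eq_add_integral hst (hint j) fun u hu => heq u hu j)
    heq hint (by simp)
  rw [zero_mul] at h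
  have h0 := (Finset.sum_eq_zero_iff_of_nonneg fun j _ => abs_nonneg _).1
    (le_antisymm h (Finset.sum_nonneg fun j _ => abs_nonneg _))
  simpa using h0 i (Finset.mem_univ i)

/-- Nothing flows from `none` back to `some i`, so the transient coordinates satisfy a closed
equation. -/
lemma IsProductIntegral.isForwardSolution {T : ℝ → Matrix ι ι ℝ}
    {p : ℝ → ℝ → Matrix (Option ι) (Option ι) ℝ}
    (hp : IsProductIntegral (fun t => fullIntensity (T t)) p) (α : ι → ℝ) :
    IsForwardSolution T α (fun t i => ∑ k, α k * p 0 t (some k) (some i)) := by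
  intro t ht i
  have he : ∀ u, ((fun i => ∑ k, α k * p 0 u (some k) (some i)) ᵥ* T u) i =
      ∑ k, α k * (p 0 u * fullIntensity (T u)) (some k) (some i) := fun u => by
    simp only [mul_fullIntensity_some, Matrix.vecMul, dotProduct, Finset.sum_mul, Finset.mul_sum]
    rw [Finset.sum_comm]
    exact Finset.sum_congr rfl fun _ _ => Finset.sum_congr rfl fun _ _ => by ring
  have hint : ∀ k, IntervalIntegrable
      (fun u => α k * (p 0 u * fullIntensity (T u)) (some k) (some i)) volume 0 t :=
    fun k => (hp 0 t le_rfl ht (some k) (some i)).1.const_mul _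
  simp only [he]
  refine ⟨?_, ?_⟩
  · simpa only [Finset.sum_fn] using IntervalIntegrable.sum Finset.univ fun k _ => hint k
  · rw [intervalIntegral.integral_finsetSum fun k _ => hint k]
    simp_rw [(hp 0 t le_rfl ht _ _).2, mul_add, Finset.sum_add_distrib,
      intervalIntegral.integral_const_mul]
    simp [Matrix.one_apply]

omit [Fintype ι] [DecidableEq ι] in
-- Right-continuity lets a visit to `none` be detected at a countable dense set of times; this
-- yields measurability and reduces path statements to countably many null sets.
lemma absorptionTime_lt_iff {Ω : Type*} {X : ℝ≥0 → Ω → Option ι}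
    (hX : ∀ ω t, ∀ᶠ u in 𝓝[>] t, X u ω = X t ω) (ω : Ω) (c : ℝ≥0∞) :
    absorptionTime X ω < c ↔
      ∃ n, (TopologicalSpace.denseSeq ℝ≥0 n : ℝ≥0∞) < c ∧
        X (TopologicalSpace.denseSeq ℝ≥0 n) ω = none := by
  simp only [absorptionTime, iInf_lt_iff, exists_prop]
  constructor
  · rintro ⟨s, hs, hsc⟩
    have h1 : ∀ᶠ u : ℝ≥0 in 𝓝[>] s, (u : ℝ≥0∞) < c :=
      nhdsWithin_le_nhds (ENNReal.continuous_coe.continuousAt.eventually_lt_const hsc)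
    obtain ⟨b, hb, hsub⟩ := (mem_nhdsGT_iff_exists_Ioo_subset' (a := s) (u' := s + 1)
      (lt_add_of_pos_right s one_pos)).1 ((hX ω s).and h1)
    obtain ⟨n, hn⟩ := (TopologicalSpace.denseRange_denseSeq ℝ≥0).exists_mem_open
      isOpen_Ioo (Set.nonempty_Ioo.2 hb)
    have := hsub hn
    exact ⟨n, this.2, this.1.trans hs⟩
  · rintro ⟨n, hn, hX⟩
    exact ⟨_, hX, hn⟩

/-- The distribution function of the time until absorption is `1 - ∑ i, v t i`, where `v` is the
solution of the forward equation. -/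
theorem IsMarkovJumpProcess.absorptionTime_law {Ω : Type*} [MeasurableSpace Ω] {P : Measure Ω}
    [IsProbabilityMeasure P] {X : ℝ≥0 → Ω → Option ι} {α : ι → ℝ} {T : ℝ → Matrix ι ι ℝ} {C : ℝ}
    (hC : 0 ≤ C) (hT : ∀ u i j, |T u i j| ≤ C)
    (hX : IsMarkovJumpProcess P X (fun a => a.elim 0 α) fun t => fullIntensity (T t)) :
    ∃ v, IsForwardSolution T α v ∧ Measurable (absorptionTime X) ∧
      ∀ t : ℝ≥0, P.real {ω | absorptionTime X ω ≤ t} = 1 - ∑ i, v t i := by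
  obtain ⟨p, hp, hmk⟩ := hX.markov
  have h2 : ∀ (s t : ℝ≥0) (i j : Option ι), s ≤ t → P.real {ω | X s ω = i ∧ X t ω = j} =
      P.real {ω | X s ω = i} * p s t i j := fun s t i j hst => by
    simpa using hmk 0 (fun _ => s) t (fun _ => i) j monotone_const hst
  have hv := hp.isForwardSolution α
  set v : ℝ → ι → ℝ := fun t i => ∑ k, α k * p 0 t (some k) (some i) with hvdef
  have hsome : ∀ (t : ℝ≥0) i, P.real {ω | X t ω = some i} = v t i := fun t i => by
    have : P.real {ω | X t ω = some i} = ∑ k, P.real {ω | X 0 ω = k ∧ X t ω = some i} := by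
      rw [← measureReal_biUnion_finset]
      · congr 1
        ext ω
        simp
      · intro a _ b _ hab
        exact Set.disjoint_left.2 fun ω h1 h2 => hab (h1.1.symm.trans h2.1)
      · exact fun k _ => (hX.measurableSet_eq 0 k).inter (hX.measurableSet_eq t _)
    rw [this]
    simp_rw [h2 0 t _ _ (zero_le (a := t)), hX.init]
    simp [Fintype.sum_option, hvdef]
  have hnone : ∀ t : ℝ≥0, P.real {ω | X t ω = none} = 1 - ∑ i, v t i := fun t => by
    have h := sum_measureReal_preimage_singleton (μ := P) (f := X t) Finset.univ
      (fun k _ => hX.measurableSet_eq t k)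
    simp only [Finset.coe_univ, Set.preimage_univ, probReal_univ, Fintype.sum_option] at h
    have h' : ∑ i, P.real (X t ⁻¹' {some i}) = ∑ i, v t i :=
      Finset.sum_congr rfl fun i _ => hsome t i
    rw [h'] at h
    exact eq_sub_of_add_eq h
  have hmeas : Measurable (absorptionTime X) := by
    refine measurable_of_Iio fun c => ?_
    have : absorptionTime X ⁻¹' Set.Iio c = ⋃ n, {ω |
        (TopologicalSpace.denseSeq ℝ≥0 n : ℝ≥0∞) < c ∧
        X (TopologicalSpace.denseSeq ℝ≥0 n) ω = none} := by
      ext ω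
      simp [absorptionTime_lt_iff hX.right_cont]
    rw [this]
    exact MeasurableSet.iUnion fun n => (MeasurableSet.const _).inter (hX.measurableSet_eq _ _)
  have hnull : ∀ s t : ℝ≥0, s ≤ t → P {ω | X s ω = none ∧ X t ω ≠ none} = 0 := by
    intro s t hst
    have : {ω | X s ω = none ∧ X t ω ≠ none} = ⋃ i : ι, {ω | X s ω = none ∧ X t ω = some i} := by
      ext ω
      simp [Option.ne_none_iff_exists']
    rw [this, measure_iUnion_null_iff]
    intro i
    have h := h2 s t none (some i) hst
    rw [hp.absorbing hC hT s.coe_nonneg (NNReal.coe_le_coe.2 hst), mul_zero, measureReal_eq_zero_iff] at h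
    exact h
  have hlt : ∀ t : ℝ≥0, P.real {ω | absorptionTime X ω < t} ≤ 1 - ∑ i, v t i := by
    intro t
    rw [← hnone t]
    refine ENNReal.toReal_mono (measure_ne_top _ _) (measure_mono_ae ?_)
    -- The Markov property forbids leaving `none` only almost surely for each pair of times, so it
    -- is invoked for the dense times alone.
    have hall : ∀ᵐ ω ∂P, ∀ n, TopologicalSpace.denseSeq ℝ≥0 n < t →
        ¬ (X (TopologicalSpace.denseSeq ℝ≥0 n) ω = none ∧ X t ω ≠ none) := by
      rw [ae_all_iff]
      intro n
      by_cases hn : TopologicalSpace.denseSeq ℝ≥0 n < t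
      · have := hnull _ _ hn.le
        filter_upwards [measure_eq_zero_iff_ae_notMem.1 this] with ω hω _
        exact hω
      · exact ae_of_all _ fun ω h => absurd h hn
    filter_upwards [hall] with ω hω hlt
    obtain ⟨n, hn, hXn⟩ := (absorptionTime_lt_iff hX.right_cont ω t).1 hlt
    by_contra hne
    exact hω n (ENNReal.coe_lt_coe.1 hn) ⟨hXn, hne⟩
  refine ⟨v, hv, hmeas, fun t => le_antisymm ?_ ?_⟩
  -- `hlt` bounds the strict event only; continuity of `v` recovers the non-strict one by letting
  -- `u` decrease to `t`.
  · have hcont : ContinuousWithinAt (fun u => 1 - ∑ i, v u i) (Set.Ioi (t : ℝ)) t := by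
      have h1 : ContinuousOn (fun u => 1 - ∑ i, v u i) (Set.Icc 0 ((t : ℝ) + 1)) :=
        continuousOn_const.sub (continuousOn_finsetSum _ fun i _ =>
          hv.continuousOn (by positivity) i)
      refine ((h1 t ⟨t.2, by linarith⟩).mono_of_mem_nhdsWithin ?_)
      filter_upwards [Ioo_mem_nhdsGT (show (t : ℝ) < t + 1 by linarith)] with u hu
      exact ⟨t.2.trans hu.1.le, hu.2.le⟩
    refine ge_of_tendsto hcont ?_
    filter_upwards [self_mem_nhdsWithin] with u (hu : (t : ℝ) < u)
    have hu0 : 0 ≤ u := t.2.trans hu.le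
    have h3 := hlt ⟨u, hu0⟩
    refine le_trans (measureReal_mono fun ω (hω : absorptionTime X ω ≤ t) => ?_) h3
    exact lt_of_le_of_lt hω (ENNReal.coe_lt_coe.2 hu)
  · rw [← hnone t]
    refine measureReal_mono fun ω (hω : X t ω = none) => ?_
    exact iInf₂_le (f := fun (t : ℝ≥0) (_ : X t ω = none) => (t : ℝ≥0∞)) t hω

end

/-! ### Construction of Markov jump processes that make boundedly many jumps -/

lemma expMeasure_real_Ioi {r : ℝ} (hr : 0 < r) {t : ℝ} (ht : 0 ≤ t) :
    (expMeasure r).real (Set.Ioi t) = Real.exp (-(r * t)) := by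
  have := isProbabilityMeasure_expMeasure hr
  have h := cdf_expMeasure_eq hr t
  rw [cdf_eq_real, if_pos ht] at h
  rw [← Set.compl_Iic, probReal_compl_eq_one_sub measurableSet_Iic, h]
  ring

lemma setIntegral_expMeasure_Ioc {r : ℝ} (hr : 0 < r) {s t : ℝ} (hs : 0 ≤ s) (hst : s ≤ t)
    (f : ℝ → ℝ) :
    ∫ u in Set.Ioc s t, f u ∂(expMeasure r) = ∫ u in s..t, r * Real.exp (-(r * u)) * f u := by
  rw [intervalIntegral.integral_of_le hst, expMeasure, gammaMeasure,
    setIntegral_withDensity_eq_setIntegral_toReal_smul (by unfold gammaPDF; fun_prop)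
      (ae_of_all _ fun u => by simp [gammaPDF]) _ measurableSet_Ioc]
  refine setIntegral_congr_fun measurableSet_Ioc fun u hu => ?_
  have hu0 : 0 ≤ u := hs.trans hu.1.le
  have := exponentialPDF_of_nonneg (r := r) hu0
  rw [exponentialPDF, exponentialPDFReal] at this
  simp only [gammaPDF, this, smul_eq_mul]
  rw [ENNReal.toReal_ofReal (by positivity)]

/-- `(μ x)` is the law under which the `S`-valued process `X` is a time-homogeneous Markov process
with right-continuous step paths and transition matrices `p`, started in `x ∈ A`. -/
structure IsJumpFamily {S Ω : Type*} [Fintype S] [DecidableEq S] [MeasurableSpace Ω]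
    (p : ℝ → Matrix S S ℝ) (A : Set S) (X : ℝ≥0 → Ω → S) (μ : S → Measure Ω) : Prop where
  measurableSet_eq : ∀ j, MeasurableSet {q : ℝ≥0 × Ω | X q.1 q.2 = j}
  right_cont : ∀ ω t, ∀ᶠ u in 𝓝[>] t, X u ω = X t ω
  left_lim : ∀ ω t, ∃ i, ∀ᶠ u in 𝓝[<] t, X u ω = i
  isProbabilityMeasure : ∀ x, IsProbabilityMeasure (μ x)
  marginal : ∀ x ∈ A, ∀ (t : ℝ≥0) j, (μ x).real {ω | X t ω = j} = p t x j
  markov : ∀ x ∈ A, ∀ (C : Finset (ℝ≥0 × S)) (s t : ℝ≥0) (i j : S),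
    (∀ c ∈ C, c.1 ≤ s) → s ≤ t →
    (μ x).real {ω | (∀ c ∈ C, X c.1 ω = c.2) ∧ X s ω = i ∧ X t ω = j} =
      (μ x).real {ω | (∀ c ∈ C, X c.1 ω = c.2) ∧ X s ω = i} * p (t - s) i j

/-- The path that stays in the first coordinate for the duration given by the second coordinate
and then follows the path of `X`. -/
noncomputable def delayedPath {S Ω : Type*} (X : ℝ≥0 → Ω → S) (t : ℝ≥0) (q : S × ℝ × Ω) : S :=
  if (t : ℝ) < q.2.1 then q.1 else X (t - q.2.1.toNNReal) q.2.2

/-- Start in `x`, hold for an exponential time, then continue from a state drawn from `R x`. -/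
noncomputable def delayedLaw {S Ω : Type*} [Fintype S] [MeasurableSpace S] [MeasurableSpace Ω]
    (r : ℝ) (R : Matrix S S ℝ) (μ : S → Measure Ω) (x : S) : Measure (S × ℝ × Ω) :=
  (Measure.dirac x).prod ((expMeasure r).prod (∑ y, ENNReal.ofReal (R x y) • μ y))

section

variable {S Ω : Type*} [Fintype S] [MeasurableSpace Ω]

lemma real_sum_smul {w : S → ℝ} (hw : ∀ y, 0 ≤ w y) (μ : S → Measure Ω)
    [∀ x, IsProbabilityMeasure (μ x)] (D : Set Ω) :
    (∑ y, ENNReal.ofReal (w y) • μ y).real D = ∑ y, w y * (μ y).real D := by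
  rw [measureReal_def, Measure.finsetSum_apply, ENNReal.toReal_sum]
  · simp [ENNReal.toReal_mul, ENNReal.toReal_ofReal (hw _), measureReal_def]
  · intro y _
    simp [ENNReal.mul_eq_top]

lemma isProbabilityMeasure_sum_smul {w : S → ℝ} (hw : ∀ y, 0 ≤ w y)
    (hw1 : ∑ y, w y = 1) (μ : S → Measure Ω) [∀ x, IsProbabilityMeasure (μ x)] :
    IsProbabilityMeasure (∑ y, ENNReal.ofReal (w y) • μ y) where
  measure_univ := by
    rw [Measure.finsetSum_apply]
    simp only [Measure.smul_apply, measure_univ, smul_eq_mul, mul_one]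
    rw [← ENNReal.ofReal_sum_of_nonneg fun y _ => hw y, hw1, ENNReal.ofReal_one]

variable [MeasurableSpace S]

lemma isProbabilityMeasure_delayedLaw {r : ℝ} (hr : 0 < r) {R : Matrix S S ℝ}
    (hR : ∀ x y, 0 ≤ R x y) (hR1 : ∀ x, ∑ y, R x y = 1) (μ : S → Measure Ω)
    [∀ x, IsProbabilityMeasure (μ x)] (x : S) : IsProbabilityMeasure (delayedLaw r R μ x) := by
  have := isProbabilityMeasure_sum_smul (hR x) (hR1 x) μ
  have := isProbabilityMeasure_expMeasure hr
  unfold delayedLaw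
  infer_instance

lemma integrable_delayedLaw_section {r : ℝ} (hr : 0 < r) {R : Matrix S S ℝ}
    (μ : S → Measure Ω) [∀ x, IsProbabilityMeasure (μ x)]
    (x : S) {B : Set (S × ℝ × Ω)} (hB : MeasurableSet B) :
    Integrable (fun u => ∑ y, R x y * (μ y).real {ω | (x, u, ω) ∈ B}) (expMeasure r) := by
  have := isProbabilityMeasure_expMeasure hr
  have hB' : MeasurableSet (Prod.mk x ⁻¹' B) := measurable_prodMk_left hB
  refine integrable_finsetSum _ fun y _ => Integrable.const_mul ?_ _
  refine Integrable.of_bound (C := 1) ?_ (ae_of_all _ fun u => ?_)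
  · exact (measurable_measure_prodMk_left hB').ennreal_toReal.aestronglyMeasurable
  · rw [Real.norm_of_nonneg measureReal_nonneg]
    exact measureReal_le_one

/-- Fubini: condition on the holding time and on the state entered afterwards. -/
lemma delayedLaw_real {r : ℝ} (hr : 0 < r) {R : Matrix S S ℝ} (hR : ∀ x y, 0 ≤ R x y)
    (hR1 : ∀ x, ∑ y, R x y = 1) (μ : S → Measure Ω) [∀ x, IsProbabilityMeasure (μ x)]
    (x : S) {B : Set (S × ℝ × Ω)} (hB : MeasurableSet B) :
    (delayedLaw r R μ x).real B =
      ∫ u, ∑ y, R x y * (μ y).real {ω | (x, u, ω) ∈ B} ∂(expMeasure r) := by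
  have := isProbabilityMeasure_sum_smul (hR x) (hR1 x) μ
  have := isProbabilityMeasure_expMeasure hr
  have hB' : MeasurableSet (Prod.mk x ⁻¹' B) := measurable_prodMk_left hB
  simp_rw [← real_sum_smul (hR x) μ]
  rw [measureReal_def, delayedLaw, Measure.prod_apply hB, lintegral_dirac' _
    (measurable_measure_prodMk_left hB), Measure.prod_apply hB']
  simp_rw [measureReal_def]
  exact (integral_toReal (measurable_measure_prodMk_left hB').aemeasurable
    (ae_of_all _ fun u => measure_lt_top _ _)).symm

end

/-! ### Transition matrices of uniformized chains -/

/-- The transition matrices of the uniformized chain with jump matrix `R` and jump rate `r`. -/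
noncomputable def uniformizedTransition {S : Type*} [Fintype S] [DecidableEq S] (r : ℝ)
    (R : Matrix S S ℝ) (t : ℝ) : Matrix S S ℝ :=
  NormedSpace.exp (t • (r • (R - 1)))

section

variable {S : Type*} [Fintype S] [DecidableEq S]

attribute [local instance] Matrix.linftyOpNormedRing Matrix.linftyOpNormedAlgebra
  Matrix.linftyOpNormedAddCommGroup Matrix.linftyOpNormedSpace

omit [DecidableEq S] in
-- Differentiating the matrix exponential needs a norm, chosen locally here; passing to entries
-- frees all later arguments from that choice.
lemma hasDerivAt_matrix_entry {M : ℝ → Matrix S S ℝ} {M' : Matrix S S ℝ} {t : ℝ}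
    (h : HasDerivAt M M' t) (i j : S) : HasDerivAt (fun u => M u i j) (M' i j) t := by
  let L : Matrix S S ℝ →ₗ[ℝ] ℝ := Matrix.entryLinearMap ℝ ℝ i j
  exact (LinearMap.toContinuousLinearMap L).hasFDerivAt.comp_hasDerivAt t h

lemma hasDerivAt_uniformizedTransition (r : ℝ) (R : Matrix S S ℝ) (t : ℝ) (i j : S) :
    HasDerivAt (fun u => uniformizedTransition r R u i j)
      ((uniformizedTransition r R t * (r • (R - 1))) i j) t :=
  hasDerivAt_matrix_entry (hasDerivAt_exp_smul_const (r • (R - 1)) t) i j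

/-- The backward equation, which drives the first-jump decomposition; the forward version serves the
product integral. -/
lemma hasDerivAt_uniformizedTransition' (r : ℝ) (R : Matrix S S ℝ) (t : ℝ) (i j : S) :
    HasDerivAt (fun u => uniformizedTransition r R u i j)
      (((r • (R - 1)) * uniformizedTransition r R t) i j) t :=
  hasDerivAt_matrix_entry (hasDerivAt_exp_smul_const' (r • (R - 1)) t) i j

lemma uniformizedTransition_zero (r : ℝ) (R : Matrix S S ℝ) : uniformizedTransition r R 0 = 1 := by
  simp [uniformizedTransition]

end

section

variable {S : Type*} [Fintype S] [DecidableEq S]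

lemma continuous_uniformizedTransition (r : ℝ) (R : Matrix S S ℝ) (i j : S) :
    Continuous (fun u => uniformizedTransition r R u i j) :=
  continuous_iff_continuousAt.2 fun t => (hasDerivAt_uniformizedTransition r R t i j).continuousAt

lemma uniformizedTransition_absorbing {r : ℝ} {R : Matrix S S ℝ} {x : S}
    (hx : ∀ y, R x y = (1 : Matrix S S ℝ) x y)
    (t : ℝ) (y : S) : uniformizedTransition r R t x y = (1 : Matrix S S ℝ) x y := by
  have h : ∀ u, HasDerivAt (fun u => uniformizedTransition r R u x y) 0 u := fun u => by
    convert! hasDerivAt_uniformizedTransition' r R u x y using 1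
    simp [Matrix.mul_apply, hx]
  rw [← uniformizedTransition_zero r R]
  exact is_const_of_deriv_eq_zero (fun u => (h u).differentiableAt) (fun u => (h u).deriv) t 0

/-- First-jump identity. By the backward equation the integrand is the derivative of `-exp(-ru)
p(t-u)`: the terms without `R` cancel. -/
lemma integral_uniformizedTransition (r : ℝ) (R : Matrix S S ℝ) (s t : ℝ) (x j : S) :
    ∫ u in s..t, r * Real.exp (-(r * u)) * (R * uniformizedTransition r R (t - u)) x j =
      Real.exp (-(r * s)) * uniformizedTransition r R (t - s) x j
        - Real.exp (-(r * t)) * (1 : Matrix S S ℝ) x j := by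
  have hd : ∀ u, HasDerivAt
      (fun u => -(Real.exp (-(r * u)) * uniformizedTransition r R (t - u) x j))
      (r * Real.exp (-(r * u)) * (R * uniformizedTransition r R (t - u)) x j) u := fun u => by
    have h1 := (hasDerivAt_uniformizedTransition' r R (t - u) x j).comp u
      ((hasDerivAt_id u).const_sub t)
    have h2 : HasDerivAt (fun u => Real.exp (-(r * u))) (Real.exp (-(r * u)) * -(r * 1)) u :=
      ((hasDerivAt_id u).const_mul r).neg.exp
    convert! (h2.mul h1).neg using 1
    simp only [Matrix.smul_mul, Matrix.smul_apply, Matrix.sub_mul, Matrix.sub_apply, one_mul,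
      smul_eq_mul, Function.comp]
    ring
  rw [intervalIntegral.integral_eq_sub_of_hasDerivAt (fun u _ => hd u)]
  · rw [sub_self, uniformizedTransition_zero]
    ring
  · refine Continuous.intervalIntegrable ?_ _ _
    simp_rw [Matrix.mul_apply]
    have := continuous_uniformizedTransition r R
    fun_prop

end

/-! ### Prepending an exponential holding time -/

section

variable {S Ω : Type*}

lemma delayedPath_right_cont {X : ℝ≥0 → Ω → S} (hX : ∀ ω t, ∀ᶠ u in 𝓝[>] t, X u ω = X t ω)
    (q : S × ℝ × Ω) (t : ℝ≥0) : ∀ᶠ u in 𝓝[>] t, delayedPath X u q = delayedPath X t q := by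
  unfold delayedPath
  by_cases h : (t : ℝ) < q.2.1
  · filter_upwards [nhdsWithin_le_nhds (NNReal.continuous_coe.continuousAt.eventually_lt_const h)]
      with u hu
    rw [if_pos hu, if_pos h]
  · have hle : q.2.1.toNNReal ≤ t := Real.toNNReal_le_iff_le_coe.2 (not_lt.1 h)
    have hlim : Tendsto (fun u : ℝ≥0 => u - q.2.1.toNNReal) (𝓝[>] t)
        (𝓝[>] (t - q.2.1.toNNReal)) := by
      refine tendsto_nhdsWithin_iff.2 ⟨?_, ?_⟩
      · exact ((continuous_id.sub continuous_const).tendsto t).mono_left nhdsWithin_le_nhds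
      · filter_upwards [self_mem_nhdsWithin] with u hu
        exact tsub_lt_tsub_right_of_le hle hu
    filter_upwards [hlim.eventually (hX q.2.2 (t - q.2.1.toNNReal)), self_mem_nhdsWithin]
      with u hu htu
    have h' : ¬ (u : ℝ) < q.2.1 := fun h' => h ((NNReal.coe_lt_coe.2 htu).trans h')
    rw [if_neg h', if_neg h, hu]

lemma delayedPath_left_lim {X : ℝ≥0 → Ω → S} (hX : ∀ ω t, ∃ i, ∀ᶠ u in 𝓝[<] t, X u ω = i)
    (q : S × ℝ × Ω) (t : ℝ≥0) : ∃ i, ∀ᶠ u in 𝓝[<] t, delayedPath X u q = i := by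
  unfold delayedPath
  by_cases h : (t : ℝ) ≤ q.2.1
  · refine ⟨q.1, ?_⟩
    filter_upwards [self_mem_nhdsWithin] with u hu
    rw [if_pos ((NNReal.coe_lt_coe.2 hu).trans_le h)]
  · obtain ⟨i, hi⟩ := hX q.2.2 (t - q.2.1.toNNReal)
    refine ⟨i, ?_⟩
    -- At `t = 0` this case means a negative holding time, which is a null event but not excluded
    -- pathwise; nothing lies to the left of `0` in `ℝ≥0`.
    rcases eq_or_ne t 0 with rfl | ht
    · simp [nhdsWithin]
    have hlt : q.2.1.toNNReal < t :=
      by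
      rw [← Real.toNNReal_coe (r := t)]
      exact (Real.toNNReal_lt_toNNReal_iff (NNReal.coe_pos.2 (pos_iff_ne_zero.2 ht))).2
        (not_le.1 h)
    have hev : ∀ᶠ u in 𝓝[<] t, q.2.1.toNNReal < u :=
      nhdsWithin_le_nhds (lt_mem_nhds hlt)
    have hlim : Tendsto (fun u : ℝ≥0 => u - q.2.1.toNNReal) (𝓝[<] t)
        (𝓝[<] (t - q.2.1.toNNReal)) := by
      refine tendsto_nhdsWithin_iff.2 ⟨?_, ?_⟩
      · exact ((continuous_id.sub continuous_const).tendsto t).mono_left nhdsWithin_le_nhds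
      · filter_upwards [self_mem_nhdsWithin, hev] with u hu hu'
        exact tsub_lt_tsub_right_of_le hu'.le hu
    filter_upwards [hlim.eventually hi, hev] with u hu hu'
    rw [if_neg (not_lt.2 (Real.toNNReal_le_iff_le_coe.1 hu'.le)), hu]

variable [MeasurableSpace S] [MeasurableSpace Ω]

lemma measurable_uncurry_of_measurableSet_eq [Fintype S] {X : ℝ≥0 → Ω → S}
    (hX : ∀ j, MeasurableSet {q : ℝ≥0 × Ω | X q.1 q.2 = j}) :
    Measurable (fun q : ℝ≥0 × Ω => X q.1 q.2) :=
  measurable_to_countable' hX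

/-- The process is evaluated at the random time `t - u`, so joint measurability in time and outcome
is needed and must be propagated. -/
lemma measurable_delayedPath {X : ℝ≥0 → Ω → S}
    (hX : Measurable (fun q : ℝ≥0 × Ω => X q.1 q.2)) :
    Measurable (fun q : ℝ≥0 × (S × ℝ × Ω) => delayedPath X q.1 q.2) := by
  unfold delayedPath
  refine Measurable.ite (measurableSet_lt (by fun_prop) (by fun_prop)) (by fun_prop) ?_
  have : Measurable (fun q : ℝ≥0 × (S × ℝ × Ω) => (q.1 - q.2.2.1.toNNReal, q.2.2.2)) := by
    fun_prop
  exact hX.comp this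

variable [Fintype S] [DecidableEq S] [MeasurableSingletonClass S]

/-- A jump at `u ∈ (s, t]` leaves time `t - u` to run from a state drawn from `R x`; a jump after
`t` leaves the path in `x`. The first-jump identity sums both contributions. At `s = 0` this gives
the marginal law, and for general `s` it is memorylessness of the holding time. -/
lemma setIntegral_delayedPath_marginal {r : ℝ} (hr : 0 < r) {R : Matrix S S ℝ}
    (hR1 : ∀ x, ∑ y, R x y = 1)
    {A : Set S} {X : ℝ≥0 → Ω → S} {μ : S → Measure Ω}
    (h : IsJumpFamily (uniformizedTransition r R) A X μ) {x : S} (hx : ∀ y, R x y ≠ 0 → y ∈ A)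
    {s t : ℝ≥0} (hst : s ≤ t) (j : S) :
    ∫ u in Set.Ioi (s : ℝ), ∑ y, R x y * (μ y).real {ω | delayedPath X t (x, u, ω) = j}
      ∂(expMeasure r) = Real.exp (-(r * s)) * uniformizedTransition r R (t - s) x j := by
  have := isProbabilityMeasure_expMeasure hr
  have := h.isProbabilityMeasure
  have hst' : (s : ℝ) ≤ t := hst
  have hXt := measurable_uncurry_of_measurableSet_eq h.measurableSet_eq
  have hB : MeasurableSet {q : S × ℝ × Ω | delayedPath X t q = j} :=
    ((measurable_delayedPath hXt).comp measurable_prodMk_left) (measurableSet_singleton j)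
  have hint := integrable_delayedLaw_section (R := R) hr μ x hB
  have hsplit := setIntegral_union (Set.Ioc_disjoint_Ioi (a := (s : ℝ)) (le_refl (t : ℝ)))
    measurableSet_Ioi hint.integrableOn hint.integrableOn
  rw [Set.Ioc_union_Ioi_eq_Ioi hst'] at hsplit
  refine hsplit.trans ?_
  simp only [Set.mem_ofPred_eq]
  have h1 : ∫ u in Set.Ioc (s : ℝ) t,
      ∑ y, R x y * (μ y).real {ω | delayedPath X t (x, u, ω) = j} ∂(expMeasure r) =
      ∫ u in Set.Ioc (s : ℝ) t, (R * uniformizedTransition r R (t - u)) x j ∂(expMeasure r) := by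
    refine setIntegral_congr_fun measurableSet_Ioc fun u hu => ?_
    have hu0 : 0 ≤ u := s.2.trans hu.1.le
    rw [Matrix.mul_apply]
    refine Finset.sum_congr rfl fun y _ => ?_
    by_cases hy : R x y = 0
    · simp [hy]
    congr 1
    have := h.marginal y (hx y hy) (t - u.toNNReal) j
    rw [NNReal.coe_sub (Real.toNNReal_le_iff_le_coe.2 hu.2), Real.coe_toNNReal _ hu0] at this
    rw [← this]
    simp [delayedPath, not_lt.2 hu.2]
  have h2 : ∫ u in Set.Ioi (t : ℝ),
      ∑ y, R x y * (μ y).real {ω | delayedPath X t (x, u, ω) = j} ∂(expMeasure r) =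
      ∫ u in Set.Ioi (t : ℝ), (1 : Matrix S S ℝ) x j ∂(expMeasure r) := by
    refine setIntegral_congr_fun measurableSet_Ioi fun u (hu : (t : ℝ) < u) => ?_
    simp only [delayedPath, if_pos hu, Matrix.one_apply]
    split_ifs with hxj <;> simp [hxj, hR1]
  rw [h1, h2, setIntegral_expMeasure_Ioc hr s.coe_nonneg hst', integral_uniformizedTransition,
    setIntegral_const, expMeasure_real_Ioi hr t.coe_nonneg, smul_eq_mul]
  ring

/-- Condition on the holding time `u`. If `u ≤ s`, the Markov property of `X` applies after shifting
time by `u`. If `u > s`, the whole past consists of staying in `x`, and memorylessness takes over.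
-/
lemma IsJumpFamily.delayed {r : ℝ} (hr : 0 < r) {R : Matrix S S ℝ} (hR : ∀ x y, 0 ≤ R x y)
    (hR1 : ∀ x, ∑ y, R x y = 1) {A A' : Set S} {X : ℝ≥0 → Ω → S} {μ : S → Measure Ω}
    (h : IsJumpFamily (uniformizedTransition r R) A X μ)
    (hA : ∀ x ∈ A', ∀ y, R x y ≠ 0 → y ∈ A) :
    IsJumpFamily (uniformizedTransition r R) A' (delayedPath X) (delayedLaw r R μ) := by
  have := isProbabilityMeasure_expMeasure hr
  have := h.isProbabilityMeasure
  have hXt := measurable_uncurry_of_measurableSet_eq h.measurableSet_eq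
  have hDt := measurable_delayedPath hXt
  have hD : ∀ t, Measurable (delayedPath X t) := fun t => hDt.comp measurable_prodMk_left
  have hBj : ∀ t j, MeasurableSet {q | delayedPath X t q = j} := fun t j =>
    hD t (measurableSet_singleton j)
  refine ⟨fun j => hDt (measurableSet_singleton j), delayedPath_right_cont h.right_cont,
    delayedPath_left_lim h.left_lim, isProbabilityMeasure_delayedLaw hr hR hR1 μ, ?_, ?_⟩
  · intro x hx t j
    have h0 := setIntegral_delayedPath_marginal hr hR1 h (hA x hx) (zero_le (a := t)) j
    rw [delayedLaw_real hr hR hR1 μ x (hBj t j)]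
    simp only [NNReal.coe_zero, mul_zero, neg_zero, Real.exp_zero, one_mul, sub_zero] at h0
    rw [← h0, ← setIntegral_univ]
    refine (setIntegral_congr_set ?_).symm
    rw [ae_eq_univ]
    have h1 := expMeasure_real_Ioi hr le_rfl
    rw [mul_zero, neg_zero, Real.exp_zero] at h1
    -- The exponential law gives full mass to the positive half-line, so integrating over it loses
    -- nothing.
    rw [prob_compl_eq_zero_iff measurableSet_Ioi]
    rwa [measureReal_def, ENNReal.toReal_eq_one_iff] at h1
  · intro x hx C s t i j hC hst
    have hCm : MeasurableSet {q | ∀ c ∈ C, delayedPath X c.1 q = c.2} := by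
      have : {q | ∀ c ∈ C, delayedPath X c.1 q = c.2} =
        ⋂ c ∈ C, {q | delayedPath X c.1 q = c.2} := by ext; simp
      rw [this]
      exact Finset.measurableSet_biInter _ fun c _ => hBj _ _
    have hB0 := hCm.inter (hBj s i)
    have hB1 := hCm.inter ((hBj s i).inter (hBj t j))
    have e0 := delayedLaw_real hr hR hR1 μ x hB0
    have e1 := delayedLaw_real hr hR hR1 μ x hB1
    have i0 := integrable_delayedLaw_section (R := R) hr μ x hB0
    have i1 := integrable_delayedLaw_section (R := R) hr μ x hB1
    refine e1.trans (Eq.trans ?_ (congrArg (· * _) e0.symm))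
    rw [← integral_add_compl (measurableSet_Iic (a := (s : ℝ))) i0,
      ← integral_add_compl (measurableSet_Iic (a := (s : ℝ))) i1, Set.compl_Iic, add_mul]
    congr 1
    · rw [← integral_mul_const]
      refine setIntegral_congr_fun measurableSet_Iic fun u (hu : u ≤ s) => ?_
      simp only [Finset.sum_mul]
      refine Finset.sum_congr rfl fun y _ => ?_
      by_cases hy : R x y = 0
      · simp [hy]
      rw [mul_assoc]
      congr 1
      set v := u.toNNReal with hv
      have hvs : v ≤ s := Real.toNNReal_le_iff_le_coe.2 hu
      -- Constraints at times before `u` see the path in `x`. If one of them demands another state,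
      -- both events are empty.
      by_cases hc : ∀ c ∈ C, (c.1 : ℝ) < u → c.2 = x
      -- The constraints met while holding are dropped and the others shifted by `v`. An unordered
      -- finite set of constraints is stable under both operations.
      · have hm := h.markov y (hA x hx y hy)
          ((C.filter fun c => u ≤ (c.1 : ℝ)).image fun c => (c.1 - v, c.2))
          (s - v) (t - v) i j ?_ (tsub_le_tsub_right hst v)
        · have hts : ((t - v : ℝ≥0) : ℝ) - ((s - v : ℝ≥0) : ℝ) = (t : ℝ) - s := by
            rw [NNReal.coe_sub hvs, NNReal.coe_sub (hvs.trans hst)]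
            ring
          rw [hts] at hm
          have hC' : ∀ ω, (∀ c ∈ (C.filter fun c => u ≤ (c.1 : ℝ)).image fun c => (c.1 - v, c.2),
              X c.1 ω = c.2) ↔ ∀ c ∈ C, delayedPath X c.1 (x, u, ω) = c.2 := by
            intro ω
            simp only [Finset.mem_image, Finset.mem_filter, delayedPath]
            constructor
            · intro hω c hcC
              split_ifs with hcu
              · exact (hc c hcC hcu).symm
              · exact hω _ ⟨c, ⟨hcC, not_lt.1 hcu⟩, rfl⟩
            · rintro hω _ ⟨c, ⟨hcC, hcu⟩, rfl⟩
              have := hω c hcC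
              rwa [if_neg (not_lt.2 hcu)] at this
          simp only [hC'] at hm
          convert! hm using 1
          · congr 1
            ext ω
            have ht : u ≤ (t : ℝ) := hu.trans hst
            simp [delayedPath, not_lt.2 hu, not_lt.2 ht, hv]
          · congr 2
            ext ω
            simp [delayedPath, not_lt.2 hu, hv]
        · simp only [Finset.mem_image, Finset.mem_filter]
          rintro _ ⟨c, ⟨hcC, -⟩, rfl⟩
          exact tsub_le_tsub_right (hC c hcC) v
      · push Not at hc
        obtain ⟨c, hcC, hcu, hcx⟩ := hc
        have : ∀ ω, ¬ ∀ c ∈ C, delayedPath X c.1 (x, u, ω) = c.2 := fun ω hω => by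
          have := hω c hcC
          rw [delayedPath, if_pos hcu] at this
          exact hcx this.symm
        have h0 : {ω | (x, u, ω) ∈ {q | ∀ c ∈ C, delayedPath X c.1 q = c.2} ∩
            {q | delayedPath X s q = i}} = ∅ := by
          ext ω; simp [-not_forall, -Prod.forall, this ω]
        have h1 : {ω | (x, u, ω) ∈ {q | ∀ c ∈ C, delayedPath X c.1 q = c.2} ∩
            ({q | delayedPath X s q = i} ∩ {q | delayedPath X t q = j})} = ∅ := by
          ext ω; simp [-not_forall, -Prod.forall, this ω]
        rw [h0, h1]
        simp
    · by_cases hc : (∀ c ∈ C, c.2 = x) ∧ i = x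
      -- Before the first jump the past event is deterministic: it holds surely here, and never in
      -- the complementary case.
      · have hpast : ∀ u : ℝ, (s : ℝ) < u → ∀ ω, (∀ c ∈ C, delayedPath X c.1 (x, u, ω) = c.2) ∧
            delayedPath X s (x, u, ω) = i := by
          intro u hu ω
          refine ⟨fun c hcC => ?_, ?_⟩
          · rw [delayedPath, if_pos ((NNReal.coe_le_coe.2 (hC c hcC)).trans_lt hu), hc.1 c hcC]
          · rw [delayedPath, if_pos hu, hc.2]
        have l1 : ∫ u in Set.Ioi (s : ℝ), ∑ y, R x y * (μ y).real {ω | (x, u, ω) ∈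
            {q | ∀ c ∈ C, delayedPath X c.1 q = c.2} ∩
            ({q | delayedPath X s q = i} ∩ {q | delayedPath X t q = j})} ∂(expMeasure r) =
            ∫ u in Set.Ioi (s : ℝ), ∑ y, R x y * (μ y).real
              {ω | delayedPath X t (x, u, ω) = j} ∂(expMeasure r) := by
          refine setIntegral_congr_fun measurableSet_Ioi fun u hu => ?_
          have : {ω | (x, u, ω) ∈ {q | ∀ c ∈ C, delayedPath X c.1 q = c.2} ∩
            ({q | delayedPath X s q = i} ∩ {q | delayedPath X t q = j})} =
            {ω | delayedPath X t (x, u, ω) = j} := by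
            ext ω
            simp only [Set.mem_ofPred_eq, Set.mem_inter_iff]
            have := hpast u hu ω
            tauto
          simp only [this]
        have l0 : ∫ u in Set.Ioi (s : ℝ), ∑ y, R x y * (μ y).real {ω | (x, u, ω) ∈
            {q | ∀ c ∈ C, delayedPath X c.1 q = c.2} ∩
            {q | delayedPath X s q = i}} ∂(expMeasure r) =
            ∫ u in Set.Ioi (s : ℝ), (1 : ℝ) ∂(expMeasure r) := by
          refine setIntegral_congr_fun measurableSet_Ioi fun u hu => ?_
          have : {ω | (x, u, ω) ∈ {q | ∀ c ∈ C, delayedPath X c.1 q = c.2} ∩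
            {q | delayedPath X s q = i}} = Set.univ := by
            ext ω
            simp only [Set.mem_ofPred_eq, Set.mem_inter_iff]
            have := hpast u hu ω
            simpa [-Prod.forall] using this
          simp only [this]
          simp [hR1]
        rw [l1, l0, setIntegral_delayedPath_marginal hr hR1 h (hA x hx) hst, setIntegral_const,
          expMeasure_real_Ioi hr s.coe_nonneg, hc.2]
        simp
      · have hpast : ∀ u : ℝ, (s : ℝ) < u → ∀ ω, ¬ ((∀ c ∈ C, delayedPath X c.1 (x, u, ω) = c.2) ∧
            delayedPath X s (x, u, ω) = i) := by
          rintro u hu ω ⟨h1, h2⟩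
          refine hc ⟨fun c hcC => ?_, ?_⟩
          · rw [← h1 c hcC, delayedPath, if_pos ((NNReal.coe_le_coe.2 (hC c hcC)).trans_lt hu)]
          · rw [← h2, delayedPath, if_pos hu]
        have l1 : ∫ u in Set.Ioi (s : ℝ), ∑ y, R x y * (μ y).real {ω | (x, u, ω) ∈
            {q | ∀ c ∈ C, delayedPath X c.1 q = c.2} ∩
            ({q | delayedPath X s q = i} ∩ {q | delayedPath X t q = j})} ∂(expMeasure r) = 0 := by
          refine (setIntegral_congr_fun measurableSet_Ioi fun u hu => ?_).trans
            (integral_zero _ _)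
          have : {ω | (x, u, ω) ∈ {q | ∀ c ∈ C, delayedPath X c.1 q = c.2} ∩
            ({q | delayedPath X s q = i} ∩ {q | delayedPath X t q = j})} = ∅ := by
            ext ω
            simp only [Set.mem_ofPred_eq, Set.mem_inter_iff]
            have := hpast u hu ω
            simp only [Set.mem_empty_iff_false]
            tauto
          simp only [this]
          simp
        have l0 : ∫ u in Set.Ioi (s : ℝ), ∑ y, R x y * (μ y).real {ω | (x, u, ω) ∈
            {q | ∀ c ∈ C, delayedPath X c.1 q = c.2} ∩
            {q | delayedPath X s q = i}} ∂(expMeasure r) = 0 := by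
          refine (setIntegral_congr_fun measurableSet_Ioi fun u hu => ?_).trans
            (integral_zero _ _)
          have : {ω | (x, u, ω) ∈ {q | ∀ c ∈ C, delayedPath X c.1 q = c.2} ∩
            {q | delayedPath X s q = i}} = ∅ := by
            ext ω
            have := hpast u hu ω
            simpa [-Prod.forall] using this
          simp only [this]
          simp
        rw [l1, l0, zero_mul]

end

/-! ### Existence of chains with a bounded number of jumps -/

section

variable {S : Type} [Fintype S] [DecidableEq S]

lemma isJumpFamily_const [MeasurableSpace S] [MeasurableSingletonClass S] {r : ℝ} {R : Matrix S S ℝ} {A : Set S}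
    (hA : ∀ x ∈ A, ∀ y, R x y = (1 : Matrix S S ℝ) x y) :
    IsJumpFamily (Ω := S) (uniformizedTransition r R) A (fun _ x => x)
      Measure.dirac := by
  have hd : ∀ (x : S) (B : Set S), (Measure.dirac x).real B = B.indicator 1 x := by
    intro x B
    rw [measureReal_def, Measure.dirac_apply' _ B.toFinite.measurableSet]
    by_cases h : x ∈ B <;> simp [h]
  refine ⟨fun j => ?_, by simp, fun ω _ => ⟨ω, by simp⟩, fun x => inferInstance, ?_, ?_⟩
  · exact measurable_snd (measurableSet_singleton j)
  · intro x hx t j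
    rw [hd, uniformizedTransition_absorbing (hA x hx), Matrix.one_apply]
    simp [Pi.single_apply, eq_comm]
  · intro x hx C s t i j _ _
    rw [hd, hd]
    by_cases hi : x = i
    · subst hi
      rw [uniformizedTransition_absorbing (hA x hx), Matrix.one_apply]
      by_cases h : x = j <;> simp [h]
    · simp [hi]

/-- Induction on the height. States of height zero are absorbing, so constant paths serve them; from
height at most `k + 1` one jump leads to height at most `k`. Starting points of larger height carry
no claim, hence the set `A` in `IsJumpFamily`. -/
lemma exists_isJumpFamily {r : ℝ} (hr : 0 < r) {R : Matrix S S ℝ} (hR : ∀ x y, 0 ≤ R x y)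
    (hR1 : ∀ x, ∑ y, R x y = 1) (h : S → ℕ)
    (h0 : ∀ x, h x = 0 → ∀ y, R x y = (1 : Matrix S S ℝ) x y)
    (hlt : ∀ x y, R x y ≠ 0 → h y ≤ h x - 1) (k : ℕ) :
    ∃ (Ω : Type) (_ : MeasurableSpace Ω) (X : ℝ≥0 → Ω → S) (μ : S → Measure Ω),
      IsJumpFamily (uniformizedTransition r R) {x | h x ≤ k} X μ := by
  induction k with
  | zero =>
    let _ : MeasurableSpace S := ⊤
    exact ⟨S, ⊤, _, _, isJumpFamily_const fun x hx => h0 x (Nat.le_zero.1 hx)⟩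
  | succ k ih =>
    obtain ⟨Ω, _, X, μ, hX⟩ := ih
    let _ : MeasurableSpace S := ⊤
    exact ⟨_, _, _, _, hX.delayed hr hR hR1 fun x (hx : h x ≤ k + 1) y hy =>
      (hlt x y hy).trans (Nat.sub_le_of_le_add hx)⟩

lemma isProductIntegral_uniformizedTransition (r : ℝ) (R : Matrix S S ℝ) :
    IsProductIntegral (fun _ => r • (R - 1)) fun s t => uniformizedTransition r R (t - s) := by
  intro s t _ _ i j
  have hd : ∀ u, HasDerivAt (fun u => uniformizedTransition r R (u - s) i j)
      ((uniformizedTransition r R (u - s) * (r • (R - 1))) i j) u := fun u => by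
    have := (hasDerivAt_uniformizedTransition r R (u - s) i j).comp u
      ((hasDerivAt_id u).sub_const s)
    rwa [mul_one] at this
  have hc : IntervalIntegrable
      (fun u => (uniformizedTransition r R (u - s) * (r • (R - 1))) i j) volume s t := by
    refine Continuous.intervalIntegrable ?_ _ _
    simp_rw [Matrix.mul_apply]
    have := continuous_uniformizedTransition r R
    fun_prop
  refine ⟨hc, ?_⟩
  rw [intervalIntegral.integral_eq_sub_of_hasDerivAt (fun u _ => hd u) hc, sub_self,
    uniformizedTransition_zero]
  ring

/-- A stochastic matrix whose chain climbs down a height function until it is absorbed is the jump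
matrix of a Markov jump process with jump rate `r`. -/
theorem exists_isMarkovJumpProcess {r : ℝ} (hr : 0 < r) {R : Matrix S S ℝ}
    (hR : ∀ x y, 0 ≤ R x y) (hR1 : ∀ x, ∑ y, R x y = 1) (h : S → ℕ)
    (h0 : ∀ x, h x = 0 → ∀ y, R x y = (1 : Matrix S S ℝ) x y)
    (hlt : ∀ x y, R x y ≠ 0 → h y ≤ h x - 1) {α : S → ℝ} (hα : ∀ x, 0 ≤ α x)
    (hα1 : ∑ x, α x = 1) :
    ∃ (Ω : Type) (_ : MeasurableSpace Ω) (P : Measure Ω) (_ : IsProbabilityMeasure P)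
      (X : ℝ≥0 → Ω → S), IsMarkovJumpProcess P X α fun _ => r • (R - 1) := by
  obtain ⟨Ω, _, X, μ, hX⟩ := exists_isJumpFamily hr hR hR1 h h0 hlt (Finset.univ.sup h)
  have hmem : ∀ x, x ∈ {x | h x ≤ Finset.univ.sup h} := fun x =>
    Finset.le_sup (f := h) (Finset.mem_univ x)
  have := hX.isProbabilityMeasure
  refine ⟨Ω, _, ∑ x, ENNReal.ofReal (α x) • μ x, isProbabilityMeasure_sum_smul hα hα1 μ, X,
    fun t i => ?_, hX.right_cont, hX.left_lim, fun i => ?_, _,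
    isProductIntegral_uniformizedTransition r R, fun n s t i j hs hst => ?_⟩
  · exact measurable_prodMk_left (x := t) (hX.measurableSet_eq i)
  · rw [real_sum_smul hα]
    simp_rw [hX.marginal _ (hmem _)]
    simp [uniformizedTransition_zero, Matrix.one_apply]
  · rw [real_sum_smul hα, real_sum_smul hα, Finset.sum_mul]
    refine Finset.sum_congr rfl fun x _ => ?_
    rw [mul_assoc]
    congr 1
    have := hX.markov x (hmem x) (Finset.univ.image fun a => (s a, i a)) (s (Fin.last n)) t
      (i (Fin.last n)) j (by simpa using fun a => hs (Fin.le_last a)) hst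
    convert! this using 2
    · congr 1
      ext ω
      simp only [Finset.mem_image, Finset.mem_univ, true_and]
      constructor
      · rintro ⟨h1, h2⟩
        exact ⟨by rintro _ ⟨a, rfl⟩; exact h1 a, h1 _, h2⟩
      · rintro ⟨h1, -, h2⟩
        exact ⟨fun a => h1 _ ⟨a, rfl⟩, h2⟩
    · congr 1
      ext ω
      simp only [Finset.mem_image, Finset.mem_univ, true_and]
      constructor
      · intro h1
        exact ⟨by rintro _ ⟨a, rfl⟩; exact h1 a, h1 _⟩
      · rintro ⟨h1, -⟩
        exact fun a => h1 _ ⟨a, rfl⟩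

end

/-! ### Poisson weights -/

/-- The probability of `ℓ` under the Poisson distribution with mean `x`. -/
noncomputable def poissonWeight (ℓ : ℕ) (x : ℝ) : ℝ := x ^ ℓ / (ℓ ! : ℝ) * Real.exp (-x)

lemma poissonWeight_nonneg (ℓ : ℕ) {x : ℝ} (hx : 0 ≤ x) : 0 ≤ poissonWeight ℓ x := by
  unfold poissonWeight
  positivity

lemma hasDerivAt_poissonWeight (ℓ : ℕ) (x : ℝ) :
    HasDerivAt (poissonWeight ℓ)
      ((if ℓ = 0 then 0 else poissonWeight (ℓ - 1) x) - poissonWeight ℓ x) x := by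
  have h2 : HasDerivAt (fun x : ℝ => Real.exp (-x)) (-Real.exp (-x)) x := by
    simpa using (hasDerivAt_neg x).exp
  have h := ((hasDerivAt_pow ℓ x).div_const (ℓ ! : ℝ)).mul h2
  convert! h using 1
  unfold poissonWeight
  rcases ℓ with _ | ℓ
  · simp
  · have : ((ℓ + 1)! : ℝ) = (ℓ + 1) * (ℓ ! : ℝ) := by rw [Nat.factorial_succ]; push_cast; ring
    have h1 : (ℓ ! : ℝ) ≠ 0 := by positivity
    have h2 : (ℓ : ℝ) + 1 ≠ 0 := by positivity
    simp only [Nat.add_eq_zero_iff, one_ne_zero, and_false, if_false, Nat.add_sub_cancel, this]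
    push_cast
    field_simp
    ring

lemma hasDerivAt_poissonWeight_mul (ℓ : ℕ) (c t : ℝ) :
    HasDerivAt (fun t => poissonWeight ℓ (c * t))
      (c * ((if ℓ = 0 then 0 else poissonWeight (ℓ - 1) (c * t)) - poissonWeight ℓ (c * t))) t := by
  have := (hasDerivAt_poissonWeight ℓ (c * t)).comp t ((hasDerivAt_id t).const_mul c)
  rw [mul_one, mul_comm] at this
  exact this

lemma continuous_poissonWeight (ℓ : ℕ) : Continuous (poissonWeight ℓ) := by
  unfold poissonWeight
  fun_prop

lemma poissonWeight_zero_right (ℓ : ℕ) : poissonWeight ℓ 0 = if ℓ = 0 then 1 else 0 := by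
  unfold poissonWeight
  split_ifs with h <;> simp [h]

lemma tendsto_poissonWeight_atTop (ℓ : ℕ) : Tendsto (poissonWeight ℓ) atTop (𝓝 0) := by
  unfold poissonWeight
  have h := (Real.tendsto_pow_mul_exp_neg_atTop_nhds_zero ℓ).div_const (ℓ ! : ℝ)
  rw [zero_div] at h
  exact h.congr fun x => by ring

lemma hasSum_poissonWeight (x : ℝ) : HasSum (fun ℓ => poissonWeight ℓ x) 1 := by
  have h := (NormedSpace.expSeries_div_hasSum_exp x).mul_right (Real.exp (-x))
  rw [← Real.exp_eq_exp_ℝ, ← Real.exp_add, add_neg_cancel, Real.exp_zero] at h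
  exact h

/-! ### Erlang weights and the matrices `Q` -/

section

variable {K p : ℕ} {s : Fin (K + 1) → ℝ≥0∞} {T : Fin K → Matrix (Fin p) (Fin p) ℝ} {n : ℕ}

lemma isProbabilityMeasure_erlang {ℓ n : ℕ} (hℓ : 1 ≤ ℓ) (hn : 1 ≤ n) :
    IsProbabilityMeasure (gammaMeasure (ℓ : ℝ) (n : ℝ)) :=
  isProbabilityMeasure_gammaMeasure (by exact_mod_cast hℓ) (by exact_mod_cast hn)

lemma erlangCDF_mono {ℓ n : ℕ} (hℓ : 1 ≤ ℓ) (hn : 1 ≤ n) {x y : ℝ≥0∞} (h : x ≤ y) :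
    erlangCDF x ℓ n ≤ erlangCDF y ℓ n := by
  have := isProbabilityMeasure_erlang hℓ hn
  exact measureReal_mono fun z (hz : _ ≤ x) => hz.trans h

lemma erlangCDF_top {ℓ n : ℕ} (hℓ : 1 ≤ ℓ) (hn : 1 ≤ n) : erlangCDF ⊤ ℓ n = 1 := by
  have := isProbabilityMeasure_erlang hℓ hn
  simp [erlangCDF]

lemma erlangCDF_zero {ℓ n : ℕ} (hℓ : 1 ≤ ℓ) (hn : 1 ≤ n) : erlangCDF 0 ℓ n = 0 := by
  have := isProbabilityMeasure_erlang hℓ hn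
  have hac : gammaMeasure (ℓ : ℝ) (n : ℝ) ≪ volume := withDensity_absolutelyContinuous _ _
  have h0 : gammaMeasure (ℓ : ℝ) (n : ℝ) (Set.Iio 0) = 0 := by
    rw [gammaMeasure, withDensity_apply _ measurableSet_Iio]
    exact lintegral_gammaPDF_of_nonpos le_rfl
  have : {y : ℝ | ENNReal.ofReal y ≤ 0} = Set.Iio 0 ∪ {0} := by
    ext y
    simp [le_iff_lt_or_eq, ENNReal.ofReal_eq_zero]
  rw [erlangCDF, this, measureReal_eq_zero_iff, measure_union_null_iff]
  exact ⟨h0, hac (by simp)⟩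

lemma erlangWeight_nonneg (hs : IsGrid s) {ℓ : ℕ} (hℓ : 1 ≤ ℓ) (hn : 1 ≤ n) (k : Fin K) :
    0 ≤ erlangCDF (s k.succ) ℓ n - erlangCDF (s k.castSucc) ℓ n :=
  sub_nonneg.2 (erlangCDF_mono hℓ hn (hs.strictMono.monotone (Fin.castSucc_lt_succ).le))

lemma sum_erlangWeight (hs : IsGrid s) {ℓ : ℕ} (hℓ : 1 ≤ ℓ) (hn : 1 ≤ n) :
    ∑ k : Fin K, (erlangCDF (s k.succ) ℓ n - erlangCDF (s k.castSucc) ℓ n) = 1 := by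
  have h := (Fin.sum_univ_succ (fun k => erlangCDF (s k) ℓ n)).symm.trans
    (Fin.sum_univ_castSucc (fun k => erlangCDF (s k) ℓ n))
  rw [hs.zero, hs.last, erlangCDF_zero hℓ hn, erlangCDF_top hℓ hn] at h
  rw [Finset.sum_sub_distrib]
  linarith

lemma stepMatrix_apply (ℓ : ℕ) (i j : Fin p) :
    stepMatrix s T n ℓ i j = (∑ k : Fin K, (erlangCDF (s k.succ) ℓ n -
      erlangCDF (s k.castSucc) ℓ n) * ((n : ℝ)⁻¹ * T k i j)) + (1 : Matrix _ _ ℝ) i j := by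
  simp [stepMatrix, Matrix.add_apply, Matrix.sum_apply]

/-- On the diagonal, each `T k i i / n` is at least `-1` and the Erlang weights form a probability
vector, so the sum cannot fall below `-1`. -/
lemma stepMatrix_nonneg (hs : IsGrid s) (hT : ∀ k, IsSubIntensity (T k)) (hn : 1 ≤ n)
    (hd : ∀ k i, |T k i i| ≤ n) {ℓ : ℕ} (hℓ : 1 ≤ ℓ) (i j : Fin p) :
    0 ≤ stepMatrix s T n ℓ i j := by
  have hn0 : (0 : ℝ) < n := by exact_mod_cast hn
  rw [stepMatrix_apply]
  by_cases hij : i = j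
  · subst hij
    rw [Matrix.one_apply_eq]
    have : ∑ k : Fin K, (erlangCDF (s k.succ) ℓ n - erlangCDF (s k.castSucc) ℓ n) * (-1) ≤
        ∑ k : Fin K, (erlangCDF (s k.succ) ℓ n -
          erlangCDF (s k.castSucc) ℓ n) * ((n : ℝ)⁻¹ * T k i i) := by
      refine Finset.sum_le_sum fun k _ => mul_le_mul_of_nonneg_left ?_
        (erlangWeight_nonneg hs hℓ hn k)
      rw [inv_mul_eq_div, le_div_iff₀ hn0]
      linarith [neg_abs_le (T k i i), hd k i]
    rw [← Finset.sum_mul, sum_erlangWeight hs hℓ hn] at this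
    linarith
  · rw [Matrix.one_apply_ne hij, add_zero]
    exact Finset.sum_nonneg fun k _ => mul_nonneg (erlangWeight_nonneg hs hℓ hn k)
      (mul_nonneg (by positivity) ((hT k).off_diag_nonneg i j hij))

lemma sum_stepMatrix_le (hs : IsGrid s) (hT : ∀ k, IsSubIntensity (T k)) (hn : 1 ≤ n)
    {ℓ : ℕ} (hℓ : 1 ≤ ℓ) (i : Fin p) : ∑ j, stepMatrix s T n ℓ i j ≤ 1 := by
  simp_rw [stepMatrix_apply, Finset.sum_add_distrib, Matrix.one_apply]
  rw [Finset.sum_comm]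
  simp only [← Finset.mul_sum, Finset.sum_ite_eq, Finset.mem_univ, if_true]
  have : ∑ k : Fin K, (erlangCDF (s k.succ) ℓ n - erlangCDF (s k.castSucc) ℓ n) *
      ((n : ℝ)⁻¹ * ∑ j, T k i j) ≤ 0 :=
    Finset.sum_nonpos fun k _ => mul_nonpos_of_nonneg_of_nonpos (erlangWeight_nonneg hs hℓ hn k)
      (mul_nonpos_of_nonneg_of_nonpos (by positivity) ((hT k).row_sum_nonpos i))
  linarith

lemma approxIntensity_same {m : ℕ} (a : Fin m) (i j : Fin p) :
    approxIntensity s T n m (a, i) (a, j) = -(n : ℝ) * (1 : Matrix _ _ ℝ) i j := by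
  simp [approxIntensity]

lemma approxIntensity_next {m : ℕ} {a b : Fin m} (hab : (b : ℕ) = a + 1) (i j : Fin p) :
    approxIntensity s T n m (a, i) (b, j) = n * stepMatrix s T n b i j := by
  have : b ≠ a := fun h => by subst h; omega
  simp [approxIntensity, this, hab]

lemma approxIntensity_other {m : ℕ} {a b : Fin m} (h : b ≠ a) (hab : (b : ℕ) ≠ a + 1)
    (i j : Fin p) : approxIntensity s T n m (a, i) (b, j) = 0 := by
  simp [approxIntensity, h, hab]

lemma sum_approxIntensity_row {m : ℕ} (a : Fin m) (i : Fin p) :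
    ∑ y, approxIntensity s T n m (a, i) y =
      -n + if (a : ℕ) + 1 < m then n * ∑ j, stepMatrix s T n (a + 1) i j else 0 := by
  rw [Fintype.sum_prod_type]
  have h : ∀ b : Fin m, ∑ j, approxIntensity s T n m (a, i) (b, j) =
      (if b = a then -(n : ℝ) else 0) +
        if (b : ℕ) = a + 1 then n * ∑ j, stepMatrix s T n (a + 1) i j else 0 := by
    intro b
    by_cases h1 : b = a
    · subst h1
      simp [approxIntensity_same, Matrix.one_apply]
    · by_cases h2 : (b : ℕ) = a + 1
      · simp [approxIntensity_next h2, h1, h2, Finset.mul_sum]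
      · simp [approxIntensity_other h1 h2, h1, h2]
  simp_rw [h, Finset.sum_add_distrib]
  congr 1
  · simp
  · split_ifs with hm
    · rw [Finset.sum_eq_single ⟨a + 1, hm⟩]
      · simp
      · intro b _ hb
        rw [if_neg]
        exact fun h => hb (Fin.ext h)
      · simp
    · refine Finset.sum_eq_zero fun b _ => if_neg fun h => hm ?_
      omega

lemma isSubIntensity_approxIntensity (hs : IsGrid s) (hT : ∀ k, IsSubIntensity (T k))
    (hn : 1 ≤ n) (hd : ∀ k i, |T k i i| ≤ n) (m : ℕ) :
    IsSubIntensity (approxIntensity s T n m) := by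
  refine ⟨?_, ?_⟩
  · rintro ⟨a, i⟩ ⟨b, j⟩ hij
    by_cases h1 : b = a
    · subst h1
      have : i ≠ j := fun h => hij (by rw [h])
      simp [approxIntensity_same, Matrix.one_apply_ne this]
    · by_cases h2 : (b : ℕ) = a + 1
      · rw [approxIntensity_next h2]
        exact mul_nonneg (Nat.cast_nonneg _) (stepMatrix_nonneg hs hT hn hd (by omega) i j)
      · rw [approxIntensity_other h1 h2]
  · rintro ⟨a, i⟩
    rw [sum_approxIntensity_row]
    have h1 := sum_stepMatrix_le (n := n) hs hT hn (Nat.le_add_left 1 a) i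
    have hn0 : (0 : ℝ) ≤ n := Nat.cast_nonneg _
    split_ifs
    · nlinarith
    · simp

/-- Here and in the next lemma, properties of `Q` are read off from the block matrix itself, because
the second claim does not assume that `n` dominates the diagonals. Only the matrices `Q_1, …,
Q_{m-1}` occur as blocks, whence `ℓ + 1 < m`. -/
lemma IsSubIntensity.stepMatrix_nonneg {m : ℕ} (h : IsSubIntensity (approxIntensity s T n m))
    (hn : 1 ≤ n) {ℓ : ℕ} (hℓ : ℓ + 1 < m) (i j : Fin p) : 0 ≤ stepMatrix s T n (ℓ + 1) i j := by
  have hn0 : (0 : ℝ) < n := by exact_mod_cast hn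
  have := h.off_diag_nonneg (⟨ℓ, by omega⟩, i) (⟨ℓ + 1, hℓ⟩, j) (by simp)
  rw [approxIntensity_next rfl] at this
  exact nonneg_of_mul_nonneg_right this hn0

lemma IsSubIntensity.sum_stepMatrix_le {m : ℕ} (h : IsSubIntensity (approxIntensity s T n m))
    (hn : 1 ≤ n) {ℓ : ℕ} (hℓ : ℓ + 1 < m) (i : Fin p) :
    ∑ j, stepMatrix s T n (ℓ + 1) i j ≤ 1 := by
  have hn0 : (0 : ℝ) < n := by exact_mod_cast hn
  have := h.row_sum_nonpos (⟨ℓ, by omega⟩, i)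
  rw [sum_approxIntensity_row, if_pos hℓ] at this
  simp only at this
  by_contra hc
  nlinarith

end

/-! ### The rows `α Q₁ ⋯ Q_ℓ` and the survival function of the approximation -/

section

variable {K p : ℕ} (s : Fin (K + 1) → ℝ≥0∞) (T : Fin K → Matrix (Fin p) (Fin p) ℝ)
  (α : Fin p → ℝ) (n : ℕ)

lemma stepRow_zero : stepRow s T α n 0 = α := by simp [stepRow]

lemma stepRow_succ (ℓ : ℕ) :
    stepRow s T α n (ℓ + 1) = stepRow s T α n ℓ ᵥ* stepMatrix s T n (ℓ + 1) := by
  simp [stepRow, List.range_succ, Matrix.vecMul_vecMul]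

/-- The total mass of the row vector `α Q₁ ⋯ Q_ℓ`. -/
noncomputable def stepMass (ℓ : ℕ) : ℝ := ∑ i, stepRow s T α n ℓ i

/-- The probability that the approximation with `m` blocks has not been absorbed by time `t`. -/
noncomputable def approxSurvival (m : ℕ) (t : ℝ) : ℝ :=
  ∑ ℓ ∈ Finset.range m, stepMass s T α n ℓ * poissonWeight ℓ (n * t)

/-- The law at time `t` of the approximation with `m` blocks, on the transient states. -/
noncomputable def approxRow (m : ℕ) (t : ℝ) : Fin m × Fin p → ℝ :=
  fun x => stepRow s T α n x.1 x.2 * poissonWeight x.1 (n * t)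

variable {s T α n}

lemma sum_vecMul_eq {ι : Type*} [Fintype ι] (a : ι → ℝ) (M : Matrix ι ι ℝ) :
    ∑ j, (a ᵥ* M) j = ∑ i, a i * ∑ j, M i j := by
  simp only [Matrix.vecMul, dotProduct, Finset.mul_sum]
  exact Finset.sum_comm

lemma stepRow_nonneg (hα : ∀ i, 0 ≤ α i) {m : ℕ}
    (h : IsSubIntensity (approxIntensity s T n m)) (hn : 1 ≤ n) {ℓ : ℕ} (hℓ : ℓ < m) (i : Fin p) :
    0 ≤ stepRow s T α n ℓ i := by
  induction ℓ generalizing i with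
  | zero => rw [stepRow_zero]; exact hα i
  | succ ℓ ih =>
    rw [stepRow_succ]
    rw [Matrix.vecMul, dotProduct]
    exact Finset.sum_nonneg fun j _ => mul_nonneg (ih (by omega) j) (h.stepMatrix_nonneg hn hℓ j i)

lemma stepMass_nonneg (hα : ∀ i, 0 ≤ α i) {m : ℕ}
    (h : IsSubIntensity (approxIntensity s T n m)) (hn : 1 ≤ n) {ℓ : ℕ} (hℓ : ℓ < m) :
    0 ≤ stepMass s T α n ℓ :=
  Finset.sum_nonneg fun i _ => stepRow_nonneg hα h hn hℓ i

lemma stepMass_succ_le (hα : ∀ i, 0 ≤ α i) {m : ℕ}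
    (h : IsSubIntensity (approxIntensity s T n m)) (hn : 1 ≤ n) {ℓ : ℕ} (hℓ : ℓ + 1 < m) :
    stepMass s T α n (ℓ + 1) ≤ stepMass s T α n ℓ := by
  rw [stepMass, stepRow_succ, sum_vecMul_eq]
  refine Finset.sum_le_sum fun i _ => ?_
  exact mul_le_of_le_one_right (stepRow_nonneg hα h hn (by omega) i) (h.sum_stepMatrix_le hn hℓ i)

lemma stepMass_le_one (hα : ∀ i, 0 ≤ α i) (hα1 : ∑ i, α i = 1) {m : ℕ}
    (h : IsSubIntensity (approxIntensity s T n m)) (hn : 1 ≤ n) {ℓ : ℕ} (hℓ : ℓ < m) :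
    stepMass s T α n ℓ ≤ 1 := by
  induction ℓ with
  | zero => simp [stepMass, stepRow_zero, hα1]
  | succ ℓ ih => exact (stepMass_succ_le hα h hn hℓ).trans (ih (by omega))

lemma sum_approxRow (m : ℕ) (t : ℝ) :
    ∑ x, approxRow s T α n m t x = approxSurvival s T α n m t := by
  simp_rw [Fintype.sum_prod_type, approxRow, ← Finset.sum_mul]
  exact Fin.sum_univ_eq_sum_range
    (fun ℓ => (∑ i, stepRow s T α n ℓ i) * poissonWeight ℓ (n * t)) m

/-- Block column `a` holds only `-n I` on the diagonal and `n Q_a` above it. The latter carries row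
`a - 1` to row `a`, so `stepRow a` factors out and the derivative of a Poisson weight remains. -/
lemma approxRow_vecMul (m : ℕ) (t : ℝ) (a : Fin m) (j : Fin p) :
    (approxRow s T α n m t ᵥ* approxIntensity s T n m) (a, j) =
      stepRow s T α n a j * (n * ((if (a : ℕ) = 0 then 0 else poissonWeight (a - 1) (n * t)) -
        poissonWeight a (n * t))) := by
  rw [Matrix.vecMul, dotProduct, Fintype.sum_prod_type]
  have h : ∀ b : Fin m, ∑ i, approxRow s T α n m t (b, i) * approxIntensity s T n m (b, i) (a, j) =
      (if b = a then -(n * (stepRow s T α n a j * poissonWeight a (n * t))) else 0) +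
      if (a : ℕ) = b + 1 then n * (stepRow s T α n a j * poissonWeight b (n * t)) else 0 := by
    intro b
    by_cases h1 : a = b
    · subst h1
      simp [approxIntensity_same, Matrix.one_apply, approxRow]
      ring
    · by_cases h2 : (a : ℕ) = b + 1
      · simp only [approxIntensity_next h2, h2, Ne.symm h1, if_true, if_false, zero_add, approxRow,
          stepRow_succ, Matrix.vecMul, dotProduct, Finset.sum_mul, Finset.mul_sum]
        exact Finset.sum_congr rfl fun i _ => by ring
      · simp [approxIntensity_other h1 h2, Ne.symm h1, h2]
  simp_rw [h, Finset.sum_add_distrib]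
  rw [Finset.sum_ite_eq' Finset.univ a, if_pos (Finset.mem_univ a)]
  by_cases h0 : (a : ℕ) = 0
  · simp [h0]
    ring
  · rw [Finset.sum_eq_single ⟨a - 1, by omega⟩]
    · rw [if_pos (by simp only; omega), if_neg h0]
      ring
    · intro b _ hb
      rw [if_neg]
      intro h
      exact hb (Fin.ext (by simp only; omega))
    · simp

lemma hasDerivAt_approxRow (m : ℕ) (t : ℝ) (x : Fin m × Fin p) :
    HasDerivAt (fun t => approxRow s T α n m t x)
      ((approxRow s T α n m t ᵥ* approxIntensity s T n m) x) t := by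
  rw [approxRow_vecMul]
  exact (hasDerivAt_poissonWeight_mul _ _ _).const_mul _

lemma approxRow_zero (m : ℕ) : approxRow s T α n m 0 = approxInit α m := by
  funext x
  rw [approxRow, mul_zero, poissonWeight_zero_right, approxInit]
  split_ifs with h
  · rw [h, stepRow_zero, mul_one]
  · rw [mul_zero]

lemma isForwardSolution_approxRow (m : ℕ) :
    IsForwardSolution (fun _ => approxIntensity s T n m) (approxInit α m)
      (approxRow s T α n m) := by
  intro t _ x
  have hc : Continuous fun u => (approxRow s T α n m u ᵥ* approxIntensity s T n m) x := by
    simp_rw [Matrix.vecMul, dotProduct]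
    have : ∀ y, Continuous fun u => approxRow s T α n m u y := fun y =>
      continuous_iff_continuousAt.2 fun u => (hasDerivAt_approxRow m u y).continuousAt
    fun_prop
  have hint := hc.intervalIntegrable (μ := volume) 0 t
  refine ⟨hint, ?_⟩
  rw [intervalIntegral.integral_eq_sub_of_hasDerivAt (fun u _ => hasDerivAt_approxRow m u x) hint,
    approxRow_zero]
  ring

/-! ### The density of the approximation -/

lemma stepRow_dotProduct_one_sub (ℓ : ℕ) :
    stepRow s T α n ℓ ⬝ᵥ ((1 - stepMatrix s T n (ℓ + 1)) *ᵥ fun _ => (1 : ℝ)) =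
      stepMass s T α n ℓ - stepMass s T α n (ℓ + 1) := by
  rw [Matrix.dotProduct_mulVec, Matrix.vecMul_sub, Matrix.vecMul_one, ← stepRow_succ,
    sub_dotProduct]
  simp [dotProduct, stepMass]

lemma approxDensity_eq {m : ℕ} (hm : 1 ≤ m) (t : ℝ) :
    approxDensity s T α n m t = (∑ ℓ ∈ Finset.range (m - 1),
      n * ((stepMass s T α n ℓ - stepMass s T α n (ℓ + 1)) * poissonWeight ℓ (n * t))) +
      n * (stepMass s T α n (m - 1) * poissonWeight (m - 1) (n * t)) := by
  obtain ⟨m, rfl⟩ := Nat.exists_eq_add_of_le' hm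
  rw [approxDensity, Nat.add_sub_cancel]
  congr 1
  · rw [Finset.range_eq_Ico, ← Finset.Ico_succ_right_eq_Icc]
    refine (Finset.sum_Ico_add' _ 0 m 1).symm.trans (Finset.sum_congr rfl fun ℓ _ => ?_)
    rw [Nat.add_sub_cancel, stepRow_dotProduct_one_sub, poissonWeight, neg_mul, mul_pow]
    ring
  · simp only [dotProduct, mul_one, poissonWeight, mul_pow, stepMass]
    rw [neg_mul]
    ring

/-- Summation by parts: differentiation lowers the index of the Poisson weight, so each weight
collects a difference of consecutive masses. The last weight has no successor and keeps its whole
mass. -/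
lemma hasDerivAt_approxSurvival {m : ℕ} (hm : 1 ≤ m) (t : ℝ) :
    HasDerivAt (approxSurvival s T α n m) (-approxDensity s T α n m t) t := by
  have h : HasDerivAt (approxSurvival s T α n m) (∑ ℓ ∈ Finset.range m, stepMass s T α n ℓ *
      (n * ((if ℓ = 0 then 0 else poissonWeight (ℓ - 1) (n * t)) - poissonWeight ℓ (n * t)))) t :=
    HasDerivAt.fun_sum fun ℓ _ => (hasDerivAt_poissonWeight_mul ℓ n t).const_mul _
  convert! h using 1
  rw [approxDensity_eq hm]
  obtain ⟨m, rfl⟩ := Nat.exists_eq_add_of_le' hm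
  rw [Nat.add_sub_cancel]
  clear hm h
  induction m with
  | zero =>
    simp
    ring
  | succ m ih =>
    rw [Finset.sum_range_succ _ (m + 1), ← ih, Finset.sum_range_succ]
    simp only [Nat.add_eq_zero_iff, one_ne_zero, and_false, if_false, Nat.add_sub_cancel]
    ring

lemma approxDensity_nonneg (hα : ∀ i, 0 ≤ α i) {m : ℕ}
    (h : IsSubIntensity (approxIntensity s T n m)) (hn : 1 ≤ n) (hm : 1 ≤ m) {t : ℝ}
    (ht : 0 ≤ t) : 0 ≤ approxDensity s T α n m t := by
  rw [approxDensity_eq hm]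
  have hnt : 0 ≤ (n : ℝ) * t := by positivity
  refine add_nonneg (Finset.sum_nonneg fun ℓ hℓ => ?_) ?_
  · have hℓ' := Finset.mem_range.1 hℓ
    have := stepMass_succ_le hα h hn (ℓ := ℓ) (by omega)
    exact mul_nonneg (Nat.cast_nonneg _) (mul_nonneg (by linarith) (poissonWeight_nonneg _ hnt))
  · exact mul_nonneg (Nat.cast_nonneg _) (mul_nonneg
      (stepMass_nonneg hα h hn (by omega)) (poissonWeight_nonneg _ hnt))

lemma continuous_approxDensity (m : ℕ) : Continuous (approxDensity s T α n m) := by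
  unfold approxDensity
  fun_prop

lemma continuous_approxSurvival (m : ℕ) : Continuous (approxSurvival s T α n m) := by
  unfold approxSurvival
  have := continuous_poissonWeight
  fun_prop

lemma approxSurvival_zero (hα1 : ∑ i, α i = 1) {m : ℕ} (hm : 1 ≤ m) :
    approxSurvival s T α n m 0 = 1 := by
  obtain ⟨m, rfl⟩ := Nat.exists_eq_add_of_le' hm
  simp [approxSurvival, poissonWeight_zero_right, stepMass, stepRow_zero, hα1]

lemma tendsto_approxSurvival (hn : 1 ≤ n) (m : ℕ) :
    Tendsto (approxSurvival s T α n m) atTop (𝓝 0) := by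
  have hn0 : (0 : ℝ) < n := by exact_mod_cast hn
  have : Tendsto (fun t : ℝ => (n : ℝ) * t) atTop atTop := tendsto_id.const_mul_atTop hn0
  have h := tendsto_finsetSum (Finset.range m) fun ℓ _ =>
    ((tendsto_poissonWeight_atTop ℓ).comp this).const_mul (stepMass s T α n ℓ)
  simp only [mul_zero, Finset.sum_const_zero] at h
  exact h

/-- The rows do not depend on `m`, so further blocks only add nonnegative terms. This monotonicity
yields the inner limit in the theorem. -/
lemma approxSurvival_mono (hα : ∀ i, 0 ≤ α i) (hn : 1 ≤ n)
    (h : ∀ m, 1 ≤ m → IsSubIntensity (approxIntensity s T n m)) {t : ℝ} (ht : 0 ≤ t) {m m' : ℕ}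
    (hmm : m ≤ m') : approxSurvival s T α n m t ≤ approxSurvival s T α n m' t := by
  refine Finset.sum_le_sum_of_subset_of_nonneg (Finset.range_mono hmm) fun ℓ hℓ _ => ?_
  exact mul_nonneg (stepMass_nonneg hα (h (ℓ + 1) (by omega)) hn (Nat.lt_succ_self ℓ))
    (poissonWeight_nonneg _ (by positivity))

/-! ### The approximation as an absorption time -/

lemma approxInit_nonneg (hα : ∀ i, 0 ≤ α i) (m : ℕ) (x) : 0 ≤ approxInit α m x := by
  unfold approxInit
  split_ifs
  exacts [hα _, le_rfl]

lemma sum_approxInit (hα1 : ∑ i, α i = 1) {m : ℕ} (hm : 1 ≤ m) : ∑ x, approxInit α m x = 1 := by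
  obtain ⟨m, rfl⟩ := Nat.exists_eq_add_of_le' hm
  simp [approxInit, Fintype.sum_prod_type, hα1]

/-- The matrix of jump probabilities of the uniformized chain. -/
noncomputable def uniformizedJump (s : Fin (K + 1) → ℝ≥0∞) (T : Fin K → Matrix (Fin p) (Fin p) ℝ)
    (n m : ℕ) : Matrix (Option (Fin m × Fin p)) (Option (Fin m × Fin p)) ℝ :=
  1 + (n : ℝ)⁻¹ • fullIntensity (approxIntensity s T n m)

lemma sum_fullIntensity_row {ι : Type*} [Fintype ι] (T : Matrix ι ι ℝ) (a : Option ι) :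
    ∑ b, fullIntensity T a b = 0 := by
  rcases a with _ | i <;> simp [fullIntensity, Fintype.sum_option]

/-- Uniformize at rate `n`. As every transient diagonal entry is `-n`, no fictitious jumps occur
there: each jump enters the next block or is absorbed. -/
theorem exists_isMarkovJumpProcess_approx (hα : ∀ i, 0 ≤ α i) (hα1 : ∑ i, α i = 1) {m : ℕ}
    (h : IsSubIntensity (approxIntensity s T n m)) (hn : 1 ≤ n) (hm : 1 ≤ m) :
    ∃ (Ω : Type) (_ : MeasurableSpace Ω) (P : Measure Ω) (_ : IsProbabilityMeasure P)
      (X : ℝ≥0 → Ω → Option (Fin m × Fin p)),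
      IsMarkovJumpProcess P X (fun a => a.elim 0 (approxInit α m))
        fun _ => fullIntensity (approxIntensity s T n m) := by
  have hn0 : (0 : ℝ) < n := by exact_mod_cast hn
  have hΛ : (n : ℝ) • (uniformizedJump s T n m - 1) =
      fullIntensity (approxIntensity s T n m) := by
    rw [uniformizedJump, add_sub_cancel_left, smul_smul, mul_inv_cancel₀ hn0.ne', one_smul]
  have hdiag : ∀ x, uniformizedJump s T n m (some x) (some x) = 0 := fun x => by
    rw [uniformizedJump, Matrix.add_apply, Matrix.one_apply_eq, Matrix.smul_apply, fullIntensity,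
      approxIntensity_same, Matrix.one_apply_eq, smul_eq_mul]
    field_simp
    ring
  have hoff : ∀ x y, x ≠ y → uniformizedJump s T n m x y =
      (n : ℝ)⁻¹ * fullIntensity (approxIntensity s T n m) x y := fun x y hxy => by
    simp [uniformizedJump, Matrix.one_apply_ne hxy]
  have hnone : ∀ y, uniformizedJump s T n m none y =
      (1 : Matrix (Option (Fin m × Fin p)) (Option (Fin m × Fin p)) ℝ) none y := fun y => by
    simp [uniformizedJump, fullIntensity]
  rw [← hΛ]
  -- The height counts the blocks still available, the current one included; it is positive on
  -- transient states and zero at `none`.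
  refine exists_isMarkovJumpProcess hn0 ?_ ?_ (fun x => x.elim 0 fun y => m - y.1) ?_ ?_ ?_ ?_
  · rintro (_ | x) y
    · rw [hnone, Matrix.one_apply]
      split_ifs <;> simp
    · by_cases hxy : some x = y
      · subst hxy
        rw [hdiag]
      · rw [hoff _ _ hxy]
        refine mul_nonneg (by positivity) ?_
        rcases y with _ | y
        · exact neg_nonneg.2 (h.row_sum_nonpos x)
        · exact h.off_diag_nonneg x y fun h => hxy (by rw [h])
  · intro x
    have h0 := sum_fullIntensity_row (approxIntensity s T n m) x
    simp_rw [uniformizedJump, Matrix.add_apply, Matrix.smul_apply, smul_eq_mul,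
      Finset.sum_add_distrib, ← Finset.mul_sum, h0]
    simp [Matrix.one_apply]
  · rintro (_ | x) hx
    · exact hnone
    · have := x.1.2
      simp only [Option.elim_some] at hx
      omega
  · rintro (_ | ⟨a, i⟩) (_ | ⟨b, j⟩) hxy
    · simp
    · simp [hnone] at hxy
    · simp
    · by_cases hE : (a, i) = (b, j)
      · rw [← hE, hdiag] at hxy
        exact absurd rfl hxy
      rw [hoff _ _ (fun h => hE (Option.some_injective _ h))] at hxy
      have h3 : approxIntensity s T n m (a, i) (b, j) ≠ 0 :=
        fun h0 => hxy (by simp [fullIntensity, h0])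
      by_cases h1 : b = a
      · subst h1
        have : i ≠ j := fun h => hE (by rw [h])
        simp [approxIntensity_same, Matrix.one_apply_ne this] at h3
      · by_cases h2 : (b : ℕ) = a + 1
        · simp only [Option.elim_some]
          omega
        · exact absurd (approxIntensity_other h1 h2 i j) h3
  · rintro (_ | x)
    · simp
    · exact approxInit_nonneg hα m x
  · simp [Fintype.sum_option, sum_approxInit hα1 hm]

/-- Uniqueness for the forward equation identifies the solution supplied by the abstract process
with the explicit `approxRow`. -/
theorem exists_absorptionTime_approx (hα : ∀ i, 0 ≤ α i) (hα1 : ∑ i, α i = 1) {m : ℕ}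
    (h : IsSubIntensity (approxIntensity s T n m)) (hn : 1 ≤ n) (hm : 1 ≤ m) :
    ∃ (Ω : Type) (_ : MeasurableSpace Ω) (P : Measure Ω) (_ : IsProbabilityMeasure P)
      (X : ℝ≥0 → Ω → Option (Fin m × Fin p)),
      IsMarkovJumpProcess P X (fun a => a.elim 0 (approxInit α m))
        (fun _ => fullIntensity (approxIntensity s T n m)) ∧
      Measurable (absorptionTime X) ∧
      ∀ t : ℝ≥0, P.real {ω | absorptionTime X ω ≤ t} = 1 - approxSurvival s T α n m t := by
  obtain ⟨Ω, _, P, _, X, hX⟩ := exists_isMarkovJumpProcess_approx hα hα1 h hn hm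
  set C := ∑ i, ∑ j, |approxIntensity s T n m i j| with hC
  have hC0 : 0 ≤ C := by positivity
  have hb : ∀ (_ : ℝ) i j, |approxIntensity s T n m i j| ≤ C := fun _ i j =>
    (Finset.single_le_sum (f := fun j => |approxIntensity s T n m i j|)
      (fun _ _ => abs_nonneg _) (Finset.mem_univ j)).trans
    (Finset.single_le_sum (f := fun i => ∑ j, |approxIntensity s T n m i j|)
      (fun _ _ => Finset.sum_nonneg fun _ _ => abs_nonneg _) (Finset.mem_univ i))
  obtain ⟨v, hv, hmeas, hlaw⟩ := hX.absorptionTime_law hC0 hb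
  refine ⟨Ω, _, P, inferInstance, X, hX, hmeas, fun t => ?_⟩
  rw [hlaw, hv.eq hC0 hb (isForwardSolution_approxRow m) t.coe_nonneg]
  congr 1
  exact sum_approxRow m t

end

/-! ### Moments of Poisson weights and of Erlang distributions -/

lemma succ_mul_poissonWeight (ℓ : ℕ) (x : ℝ) :
    ((ℓ : ℝ) + 1) * poissonWeight (ℓ + 1) x = x * poissonWeight ℓ x := by
  have h1 : (ℓ ! : ℝ) ≠ 0 := by positivity
  have h2 : (ℓ : ℝ) + 1 ≠ 0 := by positivity
  rw [poissonWeight, poissonWeight, Nat.factorial_succ]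
  push_cast
  field_simp
  ring

lemma hasSum_mul_poissonWeight (x : ℝ) : HasSum (fun ℓ : ℕ => (ℓ : ℝ) * poissonWeight ℓ x) x := by
  have h := (hasSum_poissonWeight x).mul_left x
  simp_rw [← succ_mul_poissonWeight, mul_one] at h
  rw [← hasSum_nat_add_iff' 1]
  simpa using h

lemma hasSum_mul_sub_one_mul_poissonWeight (x : ℝ) :
    HasSum (fun ℓ : ℕ => (ℓ : ℝ) * ((ℓ : ℝ) - 1) * poissonWeight ℓ x) (x ^ 2) := by
  have h := (hasSum_mul_poissonWeight x).mul_left x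
  rw [← hasSum_nat_add_iff' 1]
  have e : ∀ ℓ : ℕ, (((ℓ + 1 : ℕ) : ℝ)) * (((ℓ + 1 : ℕ) : ℝ) - 1) * poissonWeight (ℓ + 1) x =
      x * (ℓ * poissonWeight ℓ x) := fun ℓ => by
    have := succ_mul_poissonWeight ℓ x
    push_cast
    linear_combination (ℓ : ℝ) * this
  simp_rw [e]
  simpa [pow_two] using h

lemma poissonWeight_le_one (ℓ : ℕ) {x : ℝ} (hx : 0 ≤ x) : poissonWeight ℓ x ≤ 1 :=
  le_hasSum (hasSum_poissonWeight x) ℓ fun _ _ => poissonWeight_nonneg _ hx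

lemma integrable_gammaPDFReal {a r : ℝ} (ha : 0 < a) (hr : 0 < r) :
    Integrable (gammaPDFReal a r) := by
  refine ⟨(measurable_gammaPDFReal a r).aestronglyMeasurable, ?_⟩
  rw [hasFiniteIntegral_iff_ofReal (ae_of_all _ fun x => gammaPDFReal_nonneg ha hr x)]
  exact (lintegral_gammaPDF_eq_one ha hr).trans_lt ENNReal.one_lt_top

lemma integral_gammaPDFReal {a r : ℝ} (ha : 0 < a) (hr : 0 < r) :
    ∫ x, gammaPDFReal a r x = 1 := by
  rw [integral_eq_lintegral_of_nonneg_ae (ae_of_all _ fun x => gammaPDFReal_nonneg ha hr x)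
    (measurable_gammaPDFReal a r).aestronglyMeasurable]
  exact congrArg ENNReal.toReal (lintegral_gammaPDF_eq_one ha hr)

/-- Size biasing raises the shape by one, so moments of gamma laws reduce to their normalization.
The excluded point `0` is null. -/
lemma mul_gammaPDFReal {a r : ℝ} (ha : 0 < a) (hr : 0 < r) {x : ℝ} (hx : x ≠ 0) :
    x * gammaPDFReal a r x = a / r * gammaPDFReal (a + 1) r x := by
  unfold gammaPDFReal
  split_ifs with h
  · have hx0 : 0 < x := lt_of_le_of_ne h hx.symm
    have hG := (Real.Gamma_pos_of_pos ha).ne'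
    rw [Real.Gamma_add_one ha.ne', Real.rpow_add_one hr.ne', add_sub_cancel_right,
      Real.rpow_sub_one hx]
    field_simp
  · simp

lemma sq_sub_mul_gammaPDFReal {a r : ℝ} (ha : 0 < a) (hr : 0 < r) (u : ℝ) {x : ℝ} (hx : x ≠ 0) :
    gammaPDFReal a r x * (x - u) ^ 2 = (a / r * ((a + 1) / r)) * gammaPDFReal (a + 1 + 1) r x -
      2 * u * (a / r) * gammaPDFReal (a + 1) r x + u ^ 2 * gammaPDFReal a r x := by
  have h1 := mul_gammaPDFReal ha hr hx
  have h2 := mul_gammaPDFReal (add_pos ha one_pos) hr hx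
  linear_combination (x - 2 * u) * h1 + a / r * h2

lemma integrable_sq_sub_gammaMeasure {a r : ℝ} (ha : 0 < a) (hr : 0 < r) (u : ℝ) :
    Integrable (fun x => (x - u) ^ 2) (gammaMeasure a r) ∧
    ∫ x, (x - u) ^ 2 ∂(gammaMeasure a r) =
      a / r * ((a + 1) / r) - 2 * u * (a / r) + u ^ 2 := by
  have hm : Measurable (gammaPDF a r) := (measurable_gammaPDFReal a r).ennreal_ofReal
  have hfin : ∀ᵐ x : ℝ, gammaPDF a r x < ∞ := ae_of_all _ fun x => ENNReal.ofReal_lt_top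
  have hreal : ∀ x, (gammaPDF a r x).toReal = gammaPDFReal a r x := fun x =>
    ENNReal.toReal_ofReal (gammaPDFReal_nonneg ha hr x)
  have hae : (fun x => (gammaPDF a r x).toReal • (x - u) ^ 2) =ᵐ[volume] fun x =>
      (a / r * ((a + 1) / r)) * gammaPDFReal (a + 1 + 1) r x -
      2 * u * (a / r) * gammaPDFReal (a + 1) r x + u ^ 2 * gammaPDFReal a r x := by
    have : ∀ᵐ x : ℝ, x ≠ 0 := by simp [ae_iff]
    filter_upwards [this] with x hx
    rw [hreal, smul_eq_mul, sq_sub_mul_gammaPDFReal ha hr u hx]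
  have i0 := (integrable_gammaPDFReal ha hr).const_mul (u ^ 2)
  have i1 := (integrable_gammaPDFReal (add_pos ha one_pos) hr).const_mul (2 * u * (a / r))
  have i2 := (integrable_gammaPDFReal (add_pos (add_pos ha one_pos) one_pos) hr).const_mul
    (a / r * ((a + 1) / r))
  constructor
  · rw [gammaMeasure, integrable_withDensity_iff_integrable_smul' hm hfin]
    exact ((i2.sub i1).add i0).congr hae.symm
  · rw [gammaMeasure, integral_withDensity_eq_integral_toReal_smul hm hfin, integral_congr_ae hae]
    refine (integral_add (i2.sub i1) i0).trans ?_
    rw [Pi.sub_def, integral_sub i2 i1]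
    simp_rw [integral_const_mul]
    rw [integral_gammaPDFReal ha hr, integral_gammaPDFReal (add_pos ha one_pos) hr,
      integral_gammaPDFReal (add_pos (add_pos ha one_pos) one_pos) hr]
    ring

/-- Chebyshev's inequality for the Erlang distribution function. -/
lemma abs_erlangCDF_sub_le {ℓ n : ℕ} (hn : 1 ≤ n) {x : ℝ≥0∞} {u : ℝ}
    (hx : u ≠ x.toReal) :
    |erlangCDF x (ℓ + 1) n - if ENNReal.ofReal u ≤ x then 1 else 0| ≤
      (((ℓ : ℝ) + 1) / n * (((ℓ : ℝ) + 2) / n) - 2 * u * (((ℓ : ℝ) + 1) / n) + u ^ 2) /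
        (x.toReal - u) ^ 2 := by
  have hℓ : 1 ≤ ℓ + 1 := Nat.le_add_left 1 ℓ
  have hn0 : (0 : ℝ) < n := by exact_mod_cast hn
  have hP := isProbabilityMeasure_erlang hℓ hn
  have hsq : 0 < (x.toReal - u) ^ 2 := by
    have : x.toReal - u ≠ 0 := sub_ne_zero.2 hx.symm
    positivity
  obtain ⟨hint, hval⟩ := integrable_sq_sub_gammaMeasure (a := ((ℓ + 1 : ℕ) : ℝ)) (by positivity)
    hn0 u
  have hcheb := mul_meas_ge_le_integral_of_nonneg (ae_of_all _ fun y => sq_nonneg (y - u)) hint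
    ((x.toReal - u) ^ 2)
  rw [hval] at hcheb
  have hle : ∀ B : Set ℝ, (∀ y ∈ B, (x.toReal - u) ^ 2 ≤ (y - u) ^ 2) →
      (gammaMeasure ((ℓ + 1 : ℕ) : ℝ) n).real B ≤
      (((ℓ : ℝ) + 1) / n * (((ℓ : ℝ) + 2) / n) - 2 * u * (((ℓ : ℝ) + 1) / n) + u ^ 2) /
        (x.toReal - u) ^ 2 := by
    intro B hB
    rw [le_div_iff₀ hsq, mul_comm]
    refine (mul_le_mul_of_nonneg_left (measureReal_mono hB) hsq.le).trans (hcheb.trans_eq ?_)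
    push_cast
    ring
  split_ifs with h
  · have hm : MeasurableSet {y | ENNReal.ofReal y ≤ x} :=
      measurableSet_le ENNReal.measurable_ofReal measurable_const
    rw [erlangCDF, abs_sub_comm, ← probReal_compl_eq_one_sub hm, abs_of_nonneg measureReal_nonneg]
    refine hle _ fun y hy => ?_
    have hy' : x < ENNReal.ofReal y := not_le.1 hy
    -- For `x = ⊤` the exceptional event is empty, so the default `toReal ⊤ = 0` does no harm.
    have hxt : x ≠ ⊤ := hy'.ne_top
    have h1 : x.toReal < y := (ENNReal.lt_ofReal_iff_toReal_lt hxt).1 hy'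
    have h2 : u ≤ x.toReal := (ENNReal.ofReal_le_iff_le_toReal hxt).1 h
    exact pow_le_pow_left₀ (by linarith) (by linarith) 2
  · rw [sub_zero, erlangCDF, abs_of_nonneg measureReal_nonneg]
    refine hle _ fun y (hy : ENNReal.ofReal y ≤ x) => ?_
    have hxu := not_le.1 h
    have hxt : x ≠ ⊤ := hxu.ne_top
    have h1 : y ≤ x.toReal := (ENNReal.ofReal_le_iff_le_toReal hxt).1 hy
    have h2 : x.toReal < u := (ENNReal.lt_ofReal_iff_toReal_lt hxt).1 hxu
    nlinarith

/-- A bound for the distance between the Erlang distribution functions with a Poisson number of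
stages and the step at `u`. -/
noncomputable def erlangError (n : ℕ) (x u : ℝ) : ℝ :=
  if u = x then 1 else min 1 (2 * (n * u + 1) / ((n : ℝ) ^ 2 * (x - u) ^ 2))

/-- Chebyshev, averaged over the Poisson number of stages. The trivial bound `1` handles `u` near
`x`. -/
lemma sum_poissonWeight_mul_abs_erlangCDF_sub_le {n : ℕ} (hn : 1 ≤ n) (x : ℝ≥0∞) {u : ℝ}
    (hu : 0 < u) (m : ℕ) :
    ∑ ℓ ∈ Finset.range m, poissonWeight ℓ (n * u) *
      |erlangCDF x (ℓ + 1) n - if ENNReal.ofReal u ≤ x then 1 else 0| ≤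
        erlangError n x.toReal u := by
  have hn0 : (0 : ℝ) < n := by exact_mod_cast hn
  have hnu : 0 ≤ (n : ℝ) * u := by positivity
  have hone : ∑ ℓ ∈ Finset.range m, poissonWeight ℓ (n * u) *
      |erlangCDF x (ℓ + 1) n - if ENNReal.ofReal u ≤ x then 1 else 0| ≤ 1 := by
    refine le_trans (Finset.sum_le_sum fun ℓ _ => ?_) (sum_le_hasSum (Finset.range m)
      (fun _ _ => poissonWeight_nonneg _ hnu) (hasSum_poissonWeight (n * u)))
    refine mul_le_of_le_one_right (poissonWeight_nonneg _ hnu) ?_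
    have := isProbabilityMeasure_erlang (Nat.le_add_left 1 ℓ) hn
    have h1 : erlangCDF x (ℓ + 1) n ≤ 1 := measureReal_le_one
    have h0 : 0 ≤ erlangCDF x (ℓ + 1) n := measureReal_nonneg
    split_ifs <;> rw [abs_le] <;> constructor <;> linarith
  by_cases hux : u = x.toReal
  · rwa [erlangError, if_pos hux]
  rw [erlangError, if_neg hux]
  refine le_min hone ?_
  have hsq : 0 < (x.toReal - u) ^ 2 := by
    have : x.toReal - u ≠ 0 := sub_ne_zero.2 (Ne.symm hux)
    positivity
  set f : ℕ → ℝ := fun ℓ => poissonWeight ℓ (n * u) *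
    ((((ℓ : ℝ) + 1) / n * (((ℓ : ℝ) + 2) / n) - 2 * u * (((ℓ : ℝ) + 1) / n) + u ^ 2) /
        (x.toReal - u) ^ 2) with hf
  -- With `λ = nu`, `(ℓ+1)(ℓ+2) - 2λ(ℓ+1) + λ²` equals `ℓ(ℓ-1) + (4-2λ)ℓ + (2-2λ+λ²)`; its Poisson
  -- average is `2λ + 2`.
  have hsum : HasSum f (2 * (n * u + 1) / ((n : ℝ) ^ 2 * (x.toReal - u) ^ 2)) := by
    have h2 := (hasSum_mul_sub_one_mul_poissonWeight (n * u)).mul_left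
      (1 / ((n : ℝ) ^ 2 * (x.toReal - u) ^ 2))
    have h1 := (hasSum_mul_poissonWeight (n * u)).mul_left
      ((4 - 2 * (n * u)) / ((n : ℝ) ^ 2 * (x.toReal - u) ^ 2))
    have h0 := (hasSum_poissonWeight (n * u)).mul_left
      ((2 - 2 * (n * u) + (n * u) ^ 2) / ((n : ℝ) ^ 2 * (x.toReal - u) ^ 2))
    convert! (h2.add h1).add h0 using 1
    · funext ℓ
      rw [hf]
      field_simp
      ring
    · field_simp
      ring
  have hle : ∀ ℓ, poissonWeight ℓ (n * u) *
      |erlangCDF x (ℓ + 1) n - if ENNReal.ofReal u ≤ x then 1 else 0| ≤ f ℓ := fun ℓ =>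
    mul_le_mul_of_nonneg_left (abs_erlangCDF_sub_le hn hux) (poissonWeight_nonneg _ hnu)
  refine (Finset.sum_le_sum fun ℓ _ => hle ℓ).trans (sum_le_hasSum _ (fun ℓ _ => ?_) hsum)
  exact (mul_nonneg (poissonWeight_nonneg _ hnu) (abs_nonneg _)).trans (hle ℓ)

/-! ### Vanishing of the Erlang and truncation errors -/

lemma erlangError_nonneg (n : ℕ) (x : ℝ) {u : ℝ} (hu : 0 ≤ u) : 0 ≤ erlangError n x u := by
  unfold erlangError
  split_ifs
  · exact zero_le_one
  · exact le_min zero_le_one (by positivity)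

lemma erlangError_le_one (n : ℕ) (x u : ℝ) : erlangError n x u ≤ 1 := by
  unfold erlangError
  split_ifs
  exacts [le_rfl, min_le_left _ _]

lemma measurable_erlangError (n : ℕ) (x : ℝ) : Measurable (erlangError n x) := by
  unfold erlangError
  exact Measurable.ite (measurableSet_singleton x) measurable_const (by fun_prop)

lemma tendsto_erlangError {x u : ℝ} (hu : 0 ≤ u) (hux : u ≠ x) :
    Tendsto (fun n => erlangError n x u) atTop (𝓝 0) := by
  have h1 : Tendsto (fun n : ℕ => (n : ℝ)⁻¹) atTop (𝓝 0) := tendsto_inv_atTop_nhds_zero_nat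
  have h2 : Tendsto (fun n : ℕ => 2 / (x - u) ^ 2 * (u * (n : ℝ)⁻¹ + (n : ℝ)⁻¹ ^ 2)) atTop
      (𝓝 0) := by
    have := ((h1.const_mul u).add (h1.pow 2)).const_mul (2 / (x - u) ^ 2)
    simpa using this
  refine squeeze_zero' (Eventually.of_forall fun n => erlangError_nonneg n x hu) ?_ h2
  filter_upwards [eventually_ge_atTop 1] with n hn
  have hn0 : (n : ℝ) ≠ 0 := by positivity
  have hxu : x - u ≠ 0 := sub_ne_zero.2 hux.symm
  rw [erlangError, if_neg hux]
  refine (min_le_right _ _).trans_eq ?_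
  field_simp

/-- Dominated convergence with dominating constant `1`. The cap in `erlangError` supplies it, since
the Chebyshev bound can fail to be integrable near `x`. -/
lemma tendsto_integral_erlangError (x : ℝ) {b : ℝ} (hb : 0 ≤ b) :
    Tendsto (fun n => ∫ u in 0..b, erlangError n x u) atTop (𝓝 0) := by
  have h := intervalIntegral.tendsto_integral_filter_of_dominated_convergence
    (μ := volume) (a := 0) (b := b) (l := atTop) (F := fun n u => erlangError n x u)
    (f := fun _ => 0) (fun _ => (1 : ℝ))
    (Eventually.of_forall fun n => (measurable_erlangError n x).aestronglyMeasurable)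
    (Eventually.of_forall fun n => ae_of_all _ fun u hu => ?_)
    intervalIntegrable_const ?_
  · simpa using h
  · rw [Set.uIoc_of_le hb] at hu
    rw [Real.norm_of_nonneg (erlangError_nonneg n x hu.1.le)]
    exact erlangError_le_one n x u
  · have : ∀ᵐ u : ℝ, u ≠ x := by simp [ae_iff]
    filter_upwards [this] with u hux hu
    rw [Set.uIoc_of_le hb] at hu
    exact tendsto_erlangError hu.1.le hux

lemma tendsto_integral_poissonWeight (c : ℝ) (hc : 0 ≤ c) {b : ℝ} (hb : 0 ≤ b) :
    Tendsto (fun m => ∫ u in 0..b, c * poissonWeight m (c * u)) atTop (𝓝 0) := by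
  have hcont : ∀ m, Continuous fun u => c * poissonWeight m (c * u) := fun m => by
    have := continuous_poissonWeight m
    fun_prop
  have h := intervalIntegral.tendsto_integral_filter_of_dominated_convergence
    (μ := volume) (a := 0) (b := b) (l := atTop) (F := fun m u => c * poissonWeight m (c * u))
    (f := fun _ => 0) (fun _ => c)
    (Eventually.of_forall fun m => (hcont m).aestronglyMeasurable)
    (Eventually.of_forall fun m => ae_of_all _ fun u hu => ?_)
    intervalIntegrable_const (ae_of_all _ fun u _ => ?_)
  · simpa using h
  · rw [Set.uIoc_of_le hb] at hu
    have hcu : 0 ≤ c * u := mul_nonneg hc hu.1.le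
    rw [Real.norm_of_nonneg (mul_nonneg hc (poissonWeight_nonneg _ hcu))]
    exact mul_le_of_le_one_right hc (poissonWeight_le_one m hcu)
  · simpa using (hasSum_poissonWeight (c * u)).summable.tendsto_atTop_zero.const_mul c

/-! ### Convergence of the survival functions -/

section

variable {K p : ℕ} {s : Fin (K + 1) → ℝ≥0∞} {T : Fin K → Matrix (Fin p) (Fin p) ℝ}
  {α : Fin p → ℝ} {n : ℕ} {C : ℝ}

/-- This is the form of `meanIntensity` with indicators instead of Erlang distribution functions, so
the two can be compared grid point by grid point. -/
lemma piecewiseConst_apply (hs : IsGrid s) (u : ℝ) (i j : Fin p) :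
    piecewiseConst s T u i j = ∑ k : Fin K, ((if ENNReal.ofReal u ≤ s k.succ then 1 else 0) -
      (if ENNReal.ofReal u ≤ s k.castSucc then 1 else 0)) * T k i j := by
  rw [piecewiseConst, Matrix.sum_apply]
  refine Finset.sum_congr rfl fun k _ => ?_
  have hk : s k.castSucc < s k.succ := hs.strictMono Fin.castSucc_lt_succ
  by_cases h1 : ENNReal.ofReal u ≤ s k.castSucc
  · simp [h1, h1.trans hk.le, not_lt.2 h1]
  · by_cases h2 : ENNReal.ofReal u ≤ s k.succ <;> simp [h1, h2, not_le.1 h1]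

lemma abs_piecewiseConst_le (hT : ∀ k i j, |T k i j| ≤ C) (u : ℝ) (i j : Fin p) :
    |piecewiseConst s T u i j| ≤ K * C := by
  rw [piecewiseConst, Matrix.sum_apply]
  refine (Finset.abs_sum_le_sum_abs _ _).trans
    ((Finset.sum_le_card_nsmul _ _ C fun k _ => ?_).trans_eq (by simp))
  split_ifs
  · exact hT k i j
  · simpa using (abs_nonneg _).trans (hT k i j)

lemma intervalIntegrable_piecewiseConst (hT : ∀ k i j, |T k i j| ≤ C) (i j : Fin p) (a b : ℝ) :
    IntervalIntegrable (fun u => piecewiseConst s T u i j) volume a b := by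
  refine (intervalIntegrable_const (c := (K : ℝ) * C)).mono_fun ?_
    (ae_of_all _ fun u => ?_)
  · refine Measurable.aestronglyMeasurable ?_
    have : (fun u => piecewiseConst s T u i j) = fun u => ∑ k : Fin K,
        if s k.castSucc < ENNReal.ofReal u ∧ ENNReal.ofReal u ≤ s k.succ then T k i j else 0 := by
      funext u
      rw [piecewiseConst, Matrix.sum_apply]
      exact Finset.sum_congr rfl fun k _ => by split_ifs <;> rfl
    rw [this]
    refine Finset.measurable_sum _ fun k _ => Measurable.ite ?_ measurable_const measurable_const
    exact (measurableSet_lt measurable_const ENNReal.measurable_ofReal).inter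
      (measurableSet_le ENNReal.measurable_ofReal measurable_const)
  · exact (abs_piecewiseConst_le hT u i j).trans (le_abs_self _)

/-- The mean intensity `∑ₖ ω_k T_k`. -/
noncomputable def meanIntensity (s : Fin (K + 1) → ℝ≥0∞) (T : Fin K → Matrix (Fin p) (Fin p) ℝ)
    (n ℓ : ℕ) : Matrix (Fin p) (Fin p) ℝ :=
  ∑ k : Fin K, (erlangCDF (s k.succ) ℓ n - erlangCDF (s k.castSucc) ℓ n) • T k

/-- A discrete forward equation with time step `1 / n`. -/
lemma stepRow_succ_sub (hn : 1 ≤ n) (ℓ : ℕ) :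
    (n : ℝ) • (stepRow s T α n (ℓ + 1) - stepRow s T α n ℓ) =
      stepRow s T α n ℓ ᵥ* meanIntensity s T n (ℓ + 1) := by
  have hn0 : (n : ℝ) ≠ 0 := by positivity
  have : stepMatrix s T n (ℓ + 1) = (n : ℝ)⁻¹ • meanIntensity s T n (ℓ + 1) + 1 := by
    rw [stepMatrix, meanIntensity, Finset.smul_sum]
    exact congrArg (· + 1) (Finset.sum_congr rfl fun k _ => smul_comm _ _ _)
  rw [stepRow_succ, this, Matrix.vecMul_add, Matrix.vecMul_one, add_sub_cancel_right,
    Matrix.vecMul_smul, smul_smul, mul_inv_cancel₀ hn0, one_smul]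

/-- Each grid point is an endpoint of at most two intervals, hence the factor `2`. -/
lemma abs_meanIntensity_sub_le (hs : IsGrid s) (hC : 0 ≤ C) (hT : ∀ k i j, |T k i j| ≤ C)
    (ℓ : ℕ) (u : ℝ) (i j : Fin p) :
    |(meanIntensity s T n ℓ - piecewiseConst s T u) i j| ≤ C * (2 * ∑ k : Fin (K + 1),
      |erlangCDF (s k) ℓ n - if ENNReal.ofReal u ≤ s k then 1 else 0|) := by
  set d : Fin (K + 1) → ℝ := fun k =>
    erlangCDF (s k) ℓ n - if ENNReal.ofReal u ≤ s k then 1 else 0 with hd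
  have he : (meanIntensity s T n ℓ - piecewiseConst s T u) i j =
      ∑ k : Fin K, (d k.succ - d k.castSucc) * T k i j := by
    rw [Matrix.sub_apply, piecewiseConst_apply hs, meanIntensity, Matrix.sum_apply,
      ← Finset.sum_sub_distrib]
    refine Finset.sum_congr rfl fun k _ => ?_
    rw [Matrix.smul_apply, smul_eq_mul, hd]
    ring
  have h1 : ∑ k : Fin K, |d k.succ| ≤ ∑ k, |d k| := by
    rw [Fin.sum_univ_succ]
    linarith [abs_nonneg (d 0)]
  have h2 : ∑ k : Fin K, |d k.castSucc| ≤ ∑ k, |d k| := by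
    rw [Fin.sum_univ_castSucc (fun k => |d k|)]
    linarith [abs_nonneg (d (Fin.last K))]
  rw [he]
  calc |∑ k : Fin K, (d k.succ - d k.castSucc) * T k i j|
      ≤ ∑ k : Fin K, C * (|d k.succ| + |d k.castSucc|) := by
        refine (Finset.abs_sum_le_sum_abs _ _).trans (Finset.sum_le_sum fun k _ => ?_)
        rw [abs_mul, mul_comm]
        exact mul_le_mul (hT k i j) (abs_sub _ _) (abs_nonneg _) hC
    _ ≤ C * (2 * ∑ k, |d k|) := by
        rw [← Finset.mul_sum, Finset.sum_add_distrib]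
        exact mul_le_mul_of_nonneg_left (by linarith) hC

/-- The sum of `approxRow` over the blocks. -/
noncomputable def levelSum (s : Fin (K + 1) → ℝ≥0∞) (T : Fin K → Matrix (Fin p) (Fin p) ℝ)
    (α : Fin p → ℝ) (n m : ℕ) (t : ℝ) (j : Fin p) : ℝ :=
  ∑ ℓ ∈ Finset.range m, stepRow s T α n ℓ j * poissonWeight ℓ (n * t)

lemma sum_levelSum (m : ℕ) (t : ℝ) :
    ∑ j, levelSum s T α n m t j = approxSurvival s T α n m t := by
  unfold levelSum approxSurvival stepMass
  rw [Finset.sum_comm]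
  simp_rw [Finset.sum_mul]

/-- The defect of `levelSum` in the forward equation. -/
noncomputable def levelDefect (s : Fin (K + 1) → ℝ≥0∞) (T : Fin K → Matrix (Fin p) (Fin p) ℝ)
    (α : Fin p → ℝ) (n m : ℕ) (u : ℝ) (j : Fin p) : ℝ :=
  (∑ ℓ ∈ Finset.range (m + 1), poissonWeight ℓ (n * u) *
    (stepRow s T α n ℓ ᵥ* (meanIntensity s T n (ℓ + 1) - piecewiseConst s T u)) j) -
    n * poissonWeight m (n * u) * stepRow s T α n (m + 1) j

lemma hasDerivAt_levelSum (hn : 1 ≤ n) (m : ℕ) (t : ℝ) (j : Fin p) :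
    HasDerivAt (fun t => levelSum s T α n (m + 1) t j)
      (levelDefect s T α n m t j + (levelSum s T α n (m + 1) t ᵥ* piecewiseConst s T t) j) t := by
  have h : HasDerivAt (fun t => levelSum s T α n (m + 1) t j)
      (∑ ℓ ∈ Finset.range (m + 1), stepRow s T α n ℓ j *
      (n * ((if ℓ = 0 then 0 else poissonWeight (ℓ - 1) (n * t)) - poissonWeight ℓ (n * t)))) t :=
    HasDerivAt.fun_sum fun ℓ _ => (hasDerivAt_poissonWeight_mul ℓ n t).const_mul _
  have h1 : ∀ ℓ, (stepRow s T α n ℓ ᵥ* (meanIntensity s T n (ℓ + 1) - piecewiseConst s T t)) j =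
      n * (stepRow s T α n (ℓ + 1) j - stepRow s T α n ℓ j) -
        (stepRow s T α n ℓ ᵥ* piecewiseConst s T t) j := fun ℓ => by
    rw [Matrix.vecMul_sub, ← stepRow_succ_sub hn]
    rfl
  have h2 : (levelSum s T α n (m + 1) t ᵥ* piecewiseConst s T t) j =
      ∑ ℓ ∈ Finset.range (m + 1), poissonWeight ℓ (n * t) *
        (stepRow s T α n ℓ ᵥ* piecewiseConst s T t) j := by
    simp only [levelSum, Matrix.vecMul, dotProduct, Finset.sum_mul, Finset.mul_sum]
    rw [Finset.sum_comm]
    exact Finset.sum_congr rfl fun _ _ => Finset.sum_congr rfl fun _ _ => by ring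
  convert! h using 1
  rw [levelDefect, h2]
  simp_rw [h1, mul_sub]
  rw [Finset.sum_sub_distrib]
  -- Summation by parts; its boundary term is the truncation part of `levelDefect`.
  have h3 : ∀ m, (∑ ℓ ∈ Finset.range (m + 1), (poissonWeight ℓ (n * t) *
      (n * stepRow s T α n (ℓ + 1) j) - poissonWeight ℓ (n * t) * (n * stepRow s T α n ℓ j))) -
      n * poissonWeight m (n * t) * stepRow s T α n (m + 1) j =
      ∑ ℓ ∈ Finset.range (m + 1), (stepRow s T α n ℓ j * (n * (if ℓ = 0 then 0 else
        poissonWeight (ℓ - 1) (n * t))) - stepRow s T α n ℓ j * (n * poissonWeight ℓ (n * t))) := by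
    intro m
    induction m with
    | zero => simp; ring
    | succ m ih =>
      rw [Finset.sum_range_succ, Finset.sum_range_succ _ (m + 1), ← ih]
      simp only [Nat.add_eq_zero_iff, one_ne_zero, and_false, if_false, Nat.add_sub_cancel]
      ring
  rw [← h3 m]
  ring

lemma sum_abs_levelDefect_le (hs : IsGrid s) (hC : 0 ≤ C) (hT : ∀ k i j, |T k i j| ≤ C)
    (hα : ∀ i, 0 ≤ α i) (hα1 : ∑ i, α i = 1) (hn : 1 ≤ n)
    (h : ∀ m, 1 ≤ m → IsSubIntensity (approxIntensity s T n m)) (m : ℕ) {u : ℝ} (hu : 0 < u) :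
    ∑ j, |levelDefect s T α n m u j| ≤
      p * (C * (2 * ∑ k, erlangError n (s k).toReal u)) + n * poissonWeight m (n * u) := by
  have hnu : 0 ≤ (n : ℝ) * u := by positivity
  -- Level `ℓ` needs the sub-intensity hypothesis with `ℓ + 1` blocks, and the boundary term reaches
  -- level `m + 1`; this is why all block numbers are assumed admissible.
  have hmass : ∀ ℓ, ∑ i, |stepRow s T α n ℓ i| ≤ 1 := fun ℓ => by
    have h0 := fun i => stepRow_nonneg hα (h (ℓ + 1) (by omega)) hn (Nat.lt_succ_self ℓ) i
    simp_rw [abs_of_nonneg (h0 _)]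
    exact stepMass_le_one hα hα1 (h (ℓ + 1) (by omega)) hn (Nat.lt_succ_self ℓ)
  set c : ℕ → ℝ := fun ℓ => C * (2 * ∑ k : Fin (K + 1),
      |erlangCDF (s k) (ℓ + 1) n - if ENNReal.ofReal u ≤ s k then 1 else 0|) with hc
  have hc0 : ∀ ℓ, 0 ≤ c ℓ := fun ℓ => by positivity
  have hvec : ∀ ℓ, ∑ j, |(stepRow s T α n ℓ ᵥ*
      (meanIntensity s T n (ℓ + 1) - piecewiseConst s T u)) j| ≤ p * c ℓ := fun ℓ => by
    refine (sum_abs_vecMul_le (C := c ℓ) (abs_meanIntensity_sub_le hs hC hT _ u) _).trans ?_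
    rw [Fintype.card_fin]
    exact mul_le_of_le_one_right (mul_nonneg (Nat.cast_nonneg _) (hc0 ℓ)) (hmass ℓ)
  calc ∑ j, |levelDefect s T α n m u j|
      ≤ ∑ j, ((∑ ℓ ∈ Finset.range (m + 1), poissonWeight ℓ (n * u) * |(stepRow s T α n ℓ ᵥ*
        (meanIntensity s T n (ℓ + 1) - piecewiseConst s T u)) j|) +
        n * poissonWeight m (n * u) * |stepRow s T α n (m + 1) j|) := by
        refine Finset.sum_le_sum fun j _ => (abs_sub _ _).trans (add_le_add ?_ ?_)
        · refine (Finset.abs_sum_le_sum_abs _ _).trans_eq (Finset.sum_congr rfl fun ℓ _ => ?_)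
          rw [abs_mul, abs_of_nonneg (poissonWeight_nonneg ℓ hnu)]
        · rw [abs_mul, abs_of_nonneg (mul_nonneg (Nat.cast_nonneg _)
            (poissonWeight_nonneg m hnu))]
    _ = (∑ ℓ ∈ Finset.range (m + 1), poissonWeight ℓ (n * u) * ∑ j, |(stepRow s T α n ℓ ᵥ*
        (meanIntensity s T n (ℓ + 1) - piecewiseConst s T u)) j|) +
        n * poissonWeight m (n * u) * ∑ j, |stepRow s T α n (m + 1) j| := by
        rw [Finset.sum_add_distrib, Finset.sum_comm]
        simp_rw [Finset.mul_sum]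
    _ ≤ (∑ ℓ ∈ Finset.range (m + 1), poissonWeight ℓ (n * u) * (p * c ℓ)) +
        n * poissonWeight m (n * u) := by
        refine add_le_add (Finset.sum_le_sum fun ℓ _ => mul_le_mul_of_nonneg_left (hvec ℓ)
          (poissonWeight_nonneg ℓ hnu)) ?_
        exact mul_le_of_le_one_right (mul_nonneg (Nat.cast_nonneg _) (poissonWeight_nonneg m hnu))
          (hmass _)
    _ = p * (C * (2 * ∑ k, ∑ ℓ ∈ Finset.range (m + 1), poissonWeight ℓ (n * u) *
        |erlangCDF (s k) (ℓ + 1) n - if ENNReal.ofReal u ≤ s k then 1 else 0|)) +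
        n * poissonWeight m (n * u) := by
        congr 1
        rw [Finset.sum_comm]
        simp only [hc, Finset.mul_sum]
        exact Finset.sum_congr rfl fun _ _ => Finset.sum_congr rfl fun _ _ => by ring
    _ ≤ _ := by
        refine add_le_add_left ?_ _
        have := Finset.sum_le_sum fun k (_ : k ∈ Finset.univ) =>
          sum_poissonWeight_mul_abs_erlangCDF_sub_le hn (s k) hu (m + 1)
        gcongr

lemma intervalIntegrable_erlangError (n : ℕ) (x : ℝ) {b : ℝ} (hb : 0 ≤ b) :
    IntervalIntegrable (erlangError n x) volume 0 b := by
  rw [intervalIntegrable_iff_integrableOn_Ioc_of_le hb]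
  refine Measure.integrableOn_of_bounded (M := 1) (by simp)
    (measurable_erlangError n x).aestronglyMeasurable ?_
  filter_upwards [ae_restrict_mem measurableSet_Ioc] with u hu
  rw [Real.norm_of_nonneg (erlangError_nonneg n x hu.1.le)]
  exact erlangError_le_one n x u

/-- `levelSum` and `v` satisfy the same linear equation up to the integrated defect, so Grönwall
bounds their `ℓ¹` distance. -/
theorem abs_approxSurvival_sub_le (hs : IsGrid s) (hC : 0 ≤ C) (hT : ∀ k i j, |T k i j| ≤ C)
    (hα : ∀ i, 0 ≤ α i) (hα1 : ∑ i, α i = 1) {v : ℝ → Fin p → ℝ}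
    (hv : IsForwardSolution (piecewiseConst s T) α v) (hn : 1 ≤ n)
    (h : ∀ m, 1 ≤ m → IsSubIntensity (approxIntensity s T n m)) (m : ℕ) {b : ℝ} (hb : 0 ≤ b) :
    |approxSurvival s T α n (m + 1) b - ∑ i, v b i| ≤
      (p * (C * (2 * ∑ k, ∫ u in 0..b, erlangError n (s k).toReal u)) +
        ∫ u in 0..b, n * poissonWeight m (n * u)) * Real.exp (p * (K * C) * b) := by
  have hw : ∀ j, Continuous fun t => levelSum s T α n (m + 1) t j := fun j =>
    continuous_iff_continuousAt.2 fun t => (hasDerivAt_levelSum hn m t j).continuousAt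
  have hTint := fun i j => intervalIntegrable_piecewiseConst (s := s) hT i j 0
  have hwT : ∀ j t, IntervalIntegrable
      (fun u => (levelSum s T α n (m + 1) u ᵥ* piecewiseConst s T u) j) volume 0 t := fun j t => by
    simp_rw [Matrix.vecMul, dotProduct]
    simpa only [Finset.sum_fn] using IntervalIntegrable.sum Finset.univ fun i _ =>
      (hTint i j t).continuousOn_mul (hw i).continuousOn
  have hdef : ∀ j t, IntervalIntegrable (fun u => levelDefect s T α n m u j) volume 0 t := by
    intro j t
    unfold levelDefect
    refine IntervalIntegrable.sub ?_ ?_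
    · have : ∀ ℓ, IntervalIntegrable (fun u => poissonWeight ℓ (n * u) * (stepRow s T α n ℓ ᵥ*
          (meanIntensity s T n (ℓ + 1) - piecewiseConst s T u)) j) volume 0 t := fun ℓ => by
        have hc := continuous_poissonWeight ℓ
        refine IntervalIntegrable.continuousOn_mul ?_
          (Continuous.continuousOn (f := fun u : ℝ => poissonWeight ℓ (n * u)) (by fun_prop))
        simp_rw [Matrix.vecMul, dotProduct, Matrix.sub_apply]
        simpa only [Finset.sum_fn] using IntervalIntegrable.sum Finset.univ fun i _ =>
          ((intervalIntegrable_const (c := meanIntensity s T n (ℓ + 1) i j)).sub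
            (hTint i j t)).const_mul (stepRow s T α n ℓ i)
      simpa only [Finset.sum_fn] using
        IntervalIntegrable.sum (Finset.range (m + 1)) fun ℓ _ => this ℓ
    · have hc := continuous_poissonWeight m
      exact Continuous.intervalIntegrable (by fun_prop) _ _
  -- Although `T(·)` jumps, its contributions to the defect and to the linear term cancel, so the
  -- derivative formula holds at every point and the fundamental theorem of calculus applies.
  have hweq : ∀ t j, levelSum s T α n (m + 1) t j = α j +
      ((∫ u in 0..t, levelDefect s T α n m u j) +
        ∫ u in 0..t, (levelSum s T α n (m + 1) u ᵥ* piecewiseConst s T u) j) := fun t j => by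
    rw [← intervalIntegral.integral_add (hdef j t) (hwT j t),
      intervalIntegral.integral_eq_sub_of_hasDerivAt (fun u _ => hasDerivAt_levelSum hn m u j)
        ((hdef j t).add (hwT j t))]
    have h0 : levelSum s T α n (m + 1) 0 j = α j := by
      simp [levelSum, poissonWeight_zero_right, stepRow_zero]
    rw [h0]
    ring
  have hEint : ∀ t, 0 ≤ t → IntervalIntegrable
      (fun u => p * (C * (2 * ∑ k, erlangError n (s k).toReal u))) volume 0 t := fun t ht => by
    refine IntervalIntegrable.const_mul (IntervalIntegrable.const_mul
      (IntervalIntegrable.const_mul ?_ _) _) _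
    simpa only [Finset.sum_fn] using IntervalIntegrable.sum Finset.univ fun k _ =>
      intervalIntegrable_erlangError n (s k).toReal ht
  have hPint : ∀ t, IntervalIntegrable
      (fun u => n * poissonWeight m (n * u)) volume 0 t := fun t => by
    have hc := continuous_poissonWeight m
    exact Continuous.intervalIntegrable (by fun_prop) _ _
  have key := sum_abs_le_of_eq_add_integral (Λ := piecewiseConst s T) (C := K * C)
    (z := fun u => levelSum s T α n (m + 1) u - v u)
    (e := fun t j => ∫ u in 0..t, levelDefect s T α n m u j)
    (δ := p * (C * (2 * ∑ k, ∫ u in 0..b, erlangError n (s k).toReal u)) +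
        ∫ u in 0..b, n * poissonWeight m (n * u))
    (by positivity) (abs_piecewiseConst_le hT) hb
    (fun j => (hw j).continuousOn.sub (hv.continuousOn hb j)) ?_ ?_ ?_
  · rw [← sum_levelSum, ← Finset.sum_sub_distrib]
    refine (Finset.abs_sum_le_sum_abs _ _).trans (key.trans_eq ?_)
    rw [Fintype.card_fin, sub_zero]
  · intro t ht j
    simp_rw [Matrix.sub_vecMul, Pi.sub_apply]
    rw [intervalIntegral.integral_sub (hwT j t) (hv t ht.1 j).1, hweq, (hv t ht.1 j).2]
    ring
  · intro j
    simp_rw [Matrix.sub_vecMul, Pi.sub_apply]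
    exact (hwT j b).sub (hv b hb j).1
  · intro t ht
    calc ∑ j, |∫ u in 0..t, levelDefect s T α n m u j|
        ≤ ∑ j, ∫ u in 0..t, |levelDefect s T α n m u j| :=
          Finset.sum_le_sum fun j _ => intervalIntegral.abs_integral_le_integral_abs ht.1
      _ = ∫ u in 0..t, ∑ j, |levelDefect s T α n m u j| := by
          rw [intervalIntegral.integral_finsetSum]
          exact fun j _ => (hdef j t).abs
      _ ≤ ∫ u in 0..t, (p * (C * (2 * ∑ k, erlangError n (s k).toReal u)) +
            n * poissonWeight m (n * u)) := by
          refine intervalIntegral.integral_mono_on_of_le_Ioo ht.1 ?_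
            ((hEint t ht.1).add (hPint t)) fun u hu => ?_
          · simpa only [Finset.sum_fn] using
              IntervalIntegrable.sum Finset.univ fun j _ => (hdef j t).abs
          · exact sum_abs_levelDefect_le hs hC hT hα hα1 hn h m hu.1
      _ ≤ ∫ u in 0..b, (p * (C * (2 * ∑ k, erlangError n (s k).toReal u)) +
            n * poissonWeight m (n * u)) := by
          refine intervalIntegral.integral_mono_interval le_rfl ht.1 ht.2 ?_
            ((hEint b hb).add (hPint b))
          filter_upwards [ae_restrict_mem measurableSet_Ioc] with u hu
          have hu0 := hu.1.le
          have h1 : 0 ≤ ∑ k, erlangError n (s k).toReal u :=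
            Finset.sum_nonneg fun k _ => erlangError_nonneg n _ hu0
          have h2 := poissonWeight_nonneg m (x := n * u) (by positivity)
          simp only [Pi.zero_apply]
          positivity
      _ = _ := by
          rw [intervalIntegral.integral_add (hEint b hb) (hPint b)]
          simp_rw [intervalIntegral.integral_const_mul]
          rw [intervalIntegral.integral_finsetSum]
          exact fun k _ => intervalIntegrable_erlangError n (s k).toReal hb

/-- The survival function of the approximation converges, first in `m`, then in `n`. -/
theorem exists_tendsto_abs_approxSurvival_sub_le (hs : IsGrid s) (hα : ∀ i, 0 ≤ α i)
    (hα1 : ∑ i, α i = 1) {v : ℝ → Fin p → ℝ}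
    (hv : IsForwardSolution (piecewiseConst s T) α v) {b : ℝ} (hb : 0 ≤ b) :
    ∃ (A : ℕ → ℝ) (B : ℕ → ℕ → ℝ), Tendsto A atTop (𝓝 0) ∧
      (∀ n, Tendsto (B n) atTop (𝓝 0)) ∧ ∀ n, 1 ≤ n →
      (∀ m, 1 ≤ m → IsSubIntensity (approxIntensity s T n m)) → ∀ m,
        |approxSurvival s T α n (m + 1) b - ∑ i, v b i| ≤ A n + B n m := by
  set C := ∑ k, ∑ i, ∑ j, |T k i j| with hCdef
  have hC : 0 ≤ C := by positivity
  have hT : ∀ k i j, |T k i j| ≤ C := fun k i j =>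
    ((Finset.single_le_sum (f := fun j => |T k i j|)
      (fun _ _ => abs_nonneg _) (Finset.mem_univ j)).trans
    (Finset.single_le_sum (f := fun i => ∑ j, |T k i j|)
      (fun _ _ => Finset.sum_nonneg fun _ _ => abs_nonneg _) (Finset.mem_univ i))).trans
    (Finset.single_le_sum (f := fun k => ∑ i, ∑ j, |T k i j|)
      (fun _ _ => Finset.sum_nonneg fun _ _ => Finset.sum_nonneg fun _ _ => abs_nonneg _)
      (Finset.mem_univ k))
  -- `A` carries the Erlang error, which does not depend on `m`; `B` carries the truncation error.
  refine ⟨fun n => p * (C * (2 * ∑ k, ∫ u in 0..b, erlangError n (s k).toReal u)) *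
      Real.exp (p * (K * C) * b), fun n m => (∫ u in 0..b, n * poissonWeight m (n * u)) *
      Real.exp (p * (K * C) * b), ?_, fun n => ?_, fun n hn h m => ?_⟩
  · have := ((((tendsto_finsetSum Finset.univ fun k _ =>
      tendsto_integral_erlangError (s k).toReal hb).const_mul 2).const_mul C).const_mul
        (p : ℝ)).mul_const (Real.exp (p * (K * C) * b))
    simpa using this
  · simpa using (tendsto_integral_poissonWeight n (Nat.cast_nonneg n) hb).mul_const
      (Real.exp (p * (K * C) * b))
  · rw [← add_mul]
    exact abs_approxSurvival_sub_le hs hC hT hα hα1 hv hn h m hb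

end

/-! ### Quantile coupling -/

/-- The quantile function of the distribution function `G` on `[0, ∞)`. -/
noncomputable def quantile (G : ℝ≥0 → ℝ) (u : ℝ) : ℝ≥0 :=
  if u < 1 then sInf {x | u ≤ G x} else 0

/-- `u < 1` makes the set nonempty and continuity makes it closed, so the infimum is attained. -/
lemma quantile_le_iff {G : ℝ≥0 → ℝ} (hG : Continuous G) (hmono : Monotone G)
    (hlim : Tendsto G atTop (𝓝 1)) {u : ℝ} (hu : u < 1) (x : ℝ≥0) :
    quantile G u ≤ x ↔ u ≤ G x := by
  have hne : {x | u ≤ G x}.Nonempty :=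
    ((hlim.eventually (lt_mem_nhds hu)).exists).imp fun x hx => hx.le
  have hcl : IsClosed {x | u ≤ G x} := isClosed_le continuous_const hG
  rw [quantile, if_pos hu]
  constructor
  · intro h
    exact le_trans (hcl.csInf_mem hne (OrderBot.bddBelow _)) (hmono h)
  · exact fun h => csInf_le (OrderBot.bddBelow _) h

section

variable {Ω : Type*} [MeasurableSpace Ω] {P : Measure Ω} [IsProbabilityMeasure P] {τ : Ω → ℝ≥0}
  {F : ℝ≥0 → ℝ}

/-- The probability integral transform. -/
lemma real_comp_cdf_le (hF : ∀ t, P.real {ω | τ ω ≤ t} = F t) (hc : Continuous F)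
    (h0 : F 0 = 0) (hlim : Tendsto F atTop (𝓝 1)) {u : ℝ} (hu0 : 0 ≤ u) (hu1 : u ≤ 1) :
    P.real {ω | F (τ ω) ≤ u} = u := by
  have hmono : Monotone F := fun s t hst => by
    rw [← hF s, ← hF t]
    exact measureReal_mono fun ω (hω : τ ω ≤ s) => hω.trans hst
  have hF1 : ∀ t, F t ≤ 1 := fun t => hF t ▸ measureReal_le_one
  have hex : ∀ u, 0 ≤ u → u < 1 → ∃ t, F t = u := fun u hu0 hu1 => by
    obtain ⟨b, hb⟩ := (hlim.eventually (lt_mem_nhds hu1)).exists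
    have := intermediate_value_Icc (zero_le (a := b)) hc.continuousOn
    obtain ⟨t, -, ht⟩ := this ⟨by rwa [h0], hb.le⟩
    exact ⟨t, ht⟩
  rcases hu1.eq_or_lt with rfl | hu1
  · simp [hF1]
  -- `F` may have flat pieces, so for `F t = u` the event `F(τ) ≤ u` can exceed `τ ≤ t`. For the
  -- upper bound it is compared with levels `u' > u`.
  refine le_antisymm (le_of_forall_gt_imp_ge_of_dense fun u' hu' => ?_) ?_
  · rcases le_or_gt 1 u' with h1 | h1
    · exact measureReal_le_one.trans h1
    · obtain ⟨t, ht⟩ := hex u' (hu0.trans hu'.le) h1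
      rw [← ht, ← hF t]
      refine measureReal_mono fun ω (hω : F (τ ω) ≤ u) => ?_
      by_contra hlt
      have := hmono (not_le.1 hlt).le
      linarith
  · obtain ⟨t, rfl⟩ := hex u hu0 hu1
    nth_rewrite 1 [← hF t]
    exact measureReal_mono fun ω (hω : τ ω ≤ t) => hmono hω

/-- A uniform variable has no atom at `1`, so the default branch of `quantile` is almost surely
never used. -/
lemma ae_cdf_lt_one (hτ : Measurable τ) (hF : ∀ t, P.real {ω | τ ω ≤ t} = F t)
    (hc : Continuous F) (h0 : F 0 = 0) (hlim : Tendsto F atTop (𝓝 1)) :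
    ∀ᵐ ω ∂P, F (τ ω) < 1 := by
  have hm : MeasurableSet {ω | F (τ ω) < 1} :=
    measurableSet_lt (hc.measurable.comp hτ) measurable_const
  have h : P.real {ω | F (τ ω) < 1} = 1 := by
    refine le_antisymm measureReal_le_one (le_of_forall_lt_imp_le_of_dense fun u hu => ?_)
    rcases le_or_gt 0 u with hu0 | hu0
    · rw [← real_comp_cdf_le hF hc h0 hlim hu0 hu.le]
      exact measureReal_mono fun ω (hω : F (τ ω) ≤ u) => hω.trans_lt hu
    · exact hu0.le.trans measureReal_nonneg
  rw [ae_iff]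
  rw [measureReal_def, ENNReal.toReal_eq_one_iff] at h
  exact (prob_compl_eq_zero_iff hm).2 h

lemma measurable_quantile_comp {G : ℝ≥0 → ℝ} (hG : Continuous G) (hmono : Monotone G)
    (hGlim : Tendsto G atTop (𝓝 1)) {U : Ω → ℝ} (hU : Measurable U) :
    Measurable fun ω => quantile G (U ω) := by
  refine measurable_of_Iic fun x => ?_
  have : (fun ω => quantile G (U ω)) ⁻¹' Set.Iic x = {ω | U ω ≤ G x} ∪ {ω | 1 ≤ U ω} := by
    ext ω
    rcases lt_or_ge (U ω) 1 with h | h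
    · simp [quantile_le_iff hG hmono hGlim h, h]
    · simp [quantile, not_lt.2 h, h]
  rw [this]
  exact (measurableSet_le hU measurable_const).union (measurableSet_le measurable_const hU)

lemma real_quantile_le (hτ : Measurable τ) (hF : ∀ t, P.real {ω | τ ω ≤ t} = F t)
    (hc : Continuous F) (h0 : F 0 = 0) (hlim : Tendsto F atTop (𝓝 1)) {G : ℝ≥0 → ℝ}
    (hG : Continuous G) (hmono : Monotone G) (hGlim : Tendsto G atTop (𝓝 1)) (hG0 : 0 ≤ G 0)
    (x : ℝ≥0) : P.real {ω | quantile G (F (τ ω)) ≤ x} = G x := by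
  rw [← real_comp_cdf_le hF hc h0 hlim (hG0.trans (hmono zero_le)) (hmono.ge_of_tendsto hGlim x)]
  refine measureReal_congr ?_
  filter_upwards [ae_cdf_lt_one hτ hF hc h0 hlim] with ω hω
  exact propext (quantile_le_iff hG hmono hGlim hω x)

/-- The quantile coupling separates the two variables at `t` with probability `|G t - F t|`. -/
lemma real_quantile_separated_le (hτ : Measurable τ) (hF : ∀ t, P.real {ω | τ ω ≤ t} = F t)
    (hc : Continuous F) (h0 : F 0 = 0) (hlim : Tendsto F atTop (𝓝 1)) {G : ℝ≥0 → ℝ}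
    (hG : Continuous G) (hmono : Monotone G) (hGlim : Tendsto G atTop (𝓝 1)) (hG0 : 0 ≤ G 0)
    (x : ℝ≥0) : P.real {ω | ¬ (quantile G (F (τ ω)) ≤ x ↔ τ ω ≤ x)} ≤ |G x - F x| := by
  have hFmono : Monotone F := fun s t hst => by
    rw [← hF s, ← hF t]
    exact measureReal_mono fun ω (hω : τ ω ≤ s) => hω.trans hst
  have h1 := real_quantile_le hτ hF hc h0 hlim hG hmono hGlim hG0 x
  have hae := ae_cdf_lt_one hτ hF hc h0 hlim
  have hm1 : MeasurableSet {ω | quantile G (F (τ ω)) ≤ x} :=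
    measurableSet_le (measurable_quantile_comp hG hmono hGlim (hc.measurable.comp hτ))
      measurable_const
  have hm2 : MeasurableSet {ω | τ ω ≤ x} := measurableSet_le hτ measurable_const
  -- Both events are lower sets in `τ` up to null sets, so one contains the other and the symmetric
  -- difference has the difference of the probabilities.
  have hnest : ∀ {A B : Set Ω}, MeasurableSet A → MeasurableSet B → (∀ᵐ ω ∂P, ω ∈ A → ω ∈ B) →
      P.real {ω | ¬ (ω ∈ A ↔ ω ∈ B)} = P.real B - P.real A := by
    intro A B hA hB hAB
    have e1 : P.real {ω | ¬ (ω ∈ A ↔ ω ∈ B)} = P.real (B \ A) := by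
      refine measureReal_congr ?_
      filter_upwards [hAB] with ω hω
      refine propext ?_
      change (¬ (ω ∈ A ↔ ω ∈ B)) ↔ (ω ∈ B ∧ ω ∉ A)
      tauto
    have e2 : P.real (B ∩ A) = P.real A := by
      refine measureReal_congr ?_
      filter_upwards [hAB] with ω hω
      refine propext ?_
      change (ω ∈ B ∧ ω ∈ A) ↔ ω ∈ A
      tauto
    have e3 := measureReal_inter_add_sdiff (μ := P) (s := B) hA
    rw [e1]
    linarith
  rcases le_or_gt (F x) (G x) with h | h
  · have := hnest hm2 hm1 (by
      filter_upwards [hae] with ω hω (hle : τ ω ≤ x)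
      exact (quantile_le_iff hG hmono hGlim hω x).2 ((hFmono hle).trans h))
    rw [h1, hF] at this
    rw [abs_of_nonneg (sub_nonneg.2 h), ← this]
    exact measureReal_mono fun ω hω => fun h' => hω h'.symm
  · have := hnest hm1 hm2 (by
      filter_upwards [hae] with ω hω hle
      have h2 := (quantile_le_iff hG hmono hGlim hω x).1 hle
      by_contra hlt
      exact absurd (hFmono (not_le.1 hlt).le) (not_le.2 (h2.trans_lt h)))
    rw [h1, hF] at this
    rw [abs_of_neg (sub_neg.2 h), neg_sub, ← this]
    exact le_rfl

end

/-! ### From distribution functions to convergence in probability -/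

section

variable {Ω : Type*} [MeasurableSpace Ω] {P : Measure Ω} [IsProbabilityMeasure P] {τ : Ω → ℝ≥0}
  {F : ℝ≥0 → ℝ}

lemma real_quantile_dist_lt_le (hτ : Measurable τ) (hF : ∀ t, P.real {ω | τ ω ≤ t} = F t)
    (hc : Continuous F) (h0 : F 0 = 0) (hlim : Tendsto F atTop (𝓝 1)) {G : ℝ≥0 → ℝ}
    (hG : Continuous G) (hmono : Monotone G) (hGlim : Tendsto G atTop (𝓝 1)) (hG0 : 0 ≤ G 0)
    {ε : ℝ≥0} (hε : 0 < ε) (J : ℕ) :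
    P.real {ω | (ε : ℝ) < |(τ ω : ℝ) - (quantile G (F (τ ω)) : ℝ)|} ≤
      (1 - F (J * ε)) + ∑ j ∈ Finset.range (J + 1), |G (j * ε) - F (j * ε)| := by
  have hsub : {ω | (ε : ℝ) < |(τ ω : ℝ) - (quantile G (F (τ ω)) : ℝ)|} ⊆
      {ω | τ ω ≤ J * ε}ᶜ ∪ ⋃ j ∈ Finset.range (J + 1),
        {ω | ¬ (quantile G (F (τ ω)) ≤ j * ε ↔ τ ω ≤ j * ε)} := by
    intro ω hω
    by_cases hJ : τ ω ≤ J * ε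
    · right
      simp only [Set.mem_iUnion, Finset.mem_range, exists_prop]
      set y := quantile G (F (τ ω))
      have key : ∀ {a b : ℝ≥0}, a ≤ J * ε → a + ε < b →
          ∃ j : ℕ, j < J + 1 ∧ a ≤ j * ε ∧ ¬ b ≤ j * ε := fun {a b} ha hab => by
        -- The first multiple of `ε` that is at least `a` lies below `a + ε`, hence below `b`, and
        -- does not exceed `J ε`.
        refine ⟨⌈a / ε⌉₊, ?_, ?_, ?_⟩
        · refine Nat.lt_succ_of_le (Nat.ceil_le.2 ?_)
          rwa [div_le_iff₀ hε]
        · rw [← div_le_iff₀ hε]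
          exact Nat.le_ceil _
        · rw [not_le]
          have h1 := Nat.ceil_lt_add_one (zero_le (a := a / ε))
          have h2 := mul_lt_mul_of_pos_right h1 hε
          rw [add_mul, one_mul, div_mul_cancel₀ _ hε.ne'] at h2
          exact h2.trans hab
      have hω' : (ε : ℝ) < |(τ ω : ℝ) - (y : ℝ)| := hω
      rcases lt_abs.1 hω' with h | h
      · have hab : y + ε < τ ω := by
          rw [← NNReal.coe_lt_coe]; push_cast; linarith
        obtain ⟨j, hj, h1, h2⟩ := key ((le_self_add.trans hab.le).trans hJ) hab
        exact ⟨j, hj, fun h3 => h2 (h3.1 h1)⟩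
      · have hab : τ ω + ε < y := by
          rw [← NNReal.coe_lt_coe]; push_cast; linarith
        obtain ⟨j, hj, h1, h2⟩ := key hJ hab
        exact ⟨j, hj, fun h3 => h2 (h3.2 h1)⟩
    · exact Or.inl hJ
  refine (measureReal_mono hsub).trans ((measureReal_union_le _ _).trans (add_le_add ?_ ?_))
  · rw [probReal_compl_eq_one_sub (measurableSet_le hτ measurable_const), hF]
  · exact (measureReal_biUnion_finset_le _ _).trans (Finset.sum_le_sum fun j _ =>
      real_quantile_separated_le hτ hF hc h0 hlim hG hmono hGlim hG0 (j * ε))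

/-- The event splits into two disjoint one-sided deviations, whose probabilities are monotone in `m`
in opposite directions. -/
lemma exists_tendsto_real_dist_lt (hτ : Measurable τ) {σ : ℕ → Ω → ℝ≥0}
    (hσ : ∀ m, Measurable (σ m)) (hmono : ∀ ω, Monotone fun m => σ m ω) {ε : ℝ} (hε : 0 < ε) :
    ∃ l, Tendsto (fun m => P.real {ω | ε < |(τ ω : ℝ) - (σ m ω : ℝ)|}) atTop (𝓝 l) := by
  have h1 : Monotone fun m => P.real {ω | ε < (σ m ω : ℝ) - τ ω} := fun m m' h =>
    measureReal_mono fun ω (hω : ε < (σ m ω : ℝ) - τ ω) => by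
      have : (σ m ω : ℝ) ≤ σ m' ω := hmono ω h
      exact hω.trans_le (by linarith)
  have h2 : Antitone fun m => P.real {ω | ε < (τ ω : ℝ) - σ m ω} := fun m m' h =>
    measureReal_mono fun ω (hω : ε < (τ ω : ℝ) - σ m' ω) => by
      have : (σ m ω : ℝ) ≤ σ m' ω := hmono ω h
      exact hω.trans_le (by linarith)
  have t1 := tendsto_atTop_ciSup h1 ⟨1, by rintro _ ⟨m, rfl⟩; exact measureReal_le_one⟩
  have t2 := tendsto_atTop_ciInf h2 ⟨0, by rintro _ ⟨m, rfl⟩; exact measureReal_nonneg⟩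
  refine ⟨_, (t1.add t2).congr fun m => ?_⟩
  have hmeas : MeasurableSet {ω | ε < (τ ω : ℝ) - σ m ω} :=
    measurableSet_lt measurable_const (hτ.coe_nnreal_real.sub (hσ m).coe_nnreal_real)
  rw [← measureReal_union ?_ hmeas]
  · congr 1
    ext ω
    change (ε < (σ m ω : ℝ) - τ ω ∨ ε < (τ ω : ℝ) - σ m ω) ↔ ε < |(τ ω : ℝ) - (σ m ω : ℝ)|
    rw [lt_abs, neg_sub, or_comm]
  · refine Set.disjoint_left.2 fun ω (ha : ε < (σ m ω : ℝ) - τ ω)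
      (hb : ε < (τ ω : ℝ) - σ m ω) => ?_
    linarith

lemma hasDensityOnNonneg_of_real_le {Y : Ω → ℝ≥0} (hY : Measurable Y) {S f : ℝ → ℝ}
    (hYS : ∀ t : ℝ≥0, P.real {ω | Y ω ≤ t} = 1 - S t) (hS0 : S 0 = 1)
    (hS : ∀ t, HasDerivAt S (-f t) t) (hf : Continuous f) (hf0 : ∀ t, 0 ≤ t → 0 ≤ f t) :
    HasDensityOnNonneg P Y f := by
  refine ⟨hf0, ?_⟩
  have hYm : Measurable fun ω => (Y ω : ℝ) := hY.coe_nnreal_real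
  have := Measure.isProbabilityMeasure_map (μ := P) hYm.aemeasurable
  refine Measure.ext_of_Iic _ _ fun a => ?_
  rw [Measure.map_apply hYm measurableSet_Iic, withDensity_apply _ measurableSet_Iic,
    Measure.restrict_restrict measurableSet_Iic, Set.Iic_inter_Ici]
  rcases lt_or_ge a 0 with ha | ha
  · have : (fun ω => (Y ω : ℝ)) ⁻¹' Set.Iic a = ∅ := by
      ext ω
      simpa using ha.trans_le (Y ω).coe_nonneg
    rw [this, Set.Icc_eq_empty (not_le.2 ha)]
    simp
  · lift a to ℝ≥0 using ha
    have ha := a.coe_nonneg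
    have h1 := hYS a
    have h2 : ∫ t in Set.Icc (0 : ℝ) a, f t = 1 - S a := by
      rw [integral_Icc_eq_integral_Ioc, ← intervalIntegral.integral_of_le ha]
      have := intervalIntegral.integral_eq_sub_of_hasDerivAt (fun t _ => (hS t).neg)
        ((hf.neg.neg).intervalIntegrable 0 a)
      simp only [neg_neg, Pi.neg_apply, hS0] at this
      linarith
    rw [← ofReal_integral_eq_lintegral_ofReal hf.integrableOn_Icc, h2]
    · rw [← h1, measureReal_def, ENNReal.ofReal_toReal (measure_ne_top _ _)]
      congr 1
    · filter_upwards [ae_restrict_mem measurableSet_Icc] with t ht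
      exact hf0 t ht.1

lemma map_coe_eq_map_of_real_le {Ω' : Type*} [MeasurableSpace Ω'] {P' : Measure Ω'}
    [IsProbabilityMeasure P'] {Y : Ω → ℝ≥0} (hY : Measurable Y) {Z : Ω' → ℝ≥0∞}
    (hZ : Measurable Z) (h : ∀ t : ℝ≥0, P.real {ω | Y ω ≤ t} = P'.real {ω | Z ω ≤ t}) :
    P.map (fun ω => (Y ω : ℝ≥0∞)) = P'.map Z := by
  have hYm : Measurable fun ω => (Y ω : ℝ≥0∞) := hY.coe_nnreal_ennreal
  have := Measure.isProbabilityMeasure_map (μ := P) hYm.aemeasurable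
  refine Measure.ext_of_Iic _ _ fun a => ?_
  rw [Measure.map_apply hYm measurableSet_Iic, Measure.map_apply hZ measurableSet_Iic]
  rcases eq_or_ne a ⊤ with rfl | ha
  · simp
  · lift a to ℝ≥0 using ha
    have h1 := h a
    rw [measureReal_def, measureReal_def,
      ENNReal.toReal_eq_toReal_iff' (measure_ne_top _ _) (measure_ne_top _ _)] at h1
    convert! h1 using 2
    ext ω
    simp

end

/-! ### Assembling the coupling and the limits -/

section

variable {K p : ℕ} {s : Fin (K + 1) → ℝ≥0∞} {T : Fin K → Matrix (Fin p) (Fin p) ℝ}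
  {α : Fin p → ℝ} {n : ℕ}

/-- The distribution function of the approximation with `m` blocks. -/
noncomputable def approxCDF (s : Fin (K + 1) → ℝ≥0∞) (T : Fin K → Matrix (Fin p) (Fin p) ℝ)
    (α : Fin p → ℝ) (n m : ℕ) (t : ℝ≥0) : ℝ := 1 - approxSurvival s T α n m t

lemma continuous_approxCDF (m : ℕ) : Continuous (approxCDF s T α n m) :=
  continuous_const.sub ((continuous_approxSurvival m).comp NNReal.continuous_coe)

lemma monotone_approxCDF (hα : ∀ i, 0 ≤ α i) {m : ℕ}
    (h : IsSubIntensity (approxIntensity s T n m)) (hn : 1 ≤ n) (hm : 1 ≤ m) :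
    Monotone (approxCDF s T α n m) := by
  have hanti : AntitoneOn (approxSurvival s T α n m) (Set.Ici 0) := by
    refine antitoneOn_of_hasDerivWithinAt_nonpos (convex_Ici 0)
      (continuous_approxSurvival m).continuousOn
      (fun t _ => (hasDerivAt_approxSurvival hm t).hasDerivWithinAt) fun t ht => ?_
    exact neg_nonpos.2 (approxDensity_nonneg hα h hn hm (interior_subset ht))
  exact fun t t' htt => sub_le_sub_left (hanti t.coe_nonneg t'.coe_nonneg htt) _

lemma tendsto_approxCDF (hn : 1 ≤ n) (m : ℕ) : Tendsto (approxCDF s T α n m) atTop (𝓝 1) := by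
  have h := (tendsto_approxSurvival (s := s) (T := T) (α := α) hn m).comp
    (NNReal.tendsto_coe_atTop.2 tendsto_id)
  have h1 := h.const_sub 1
  rw [sub_zero] at h1
  exact h1

lemma approxCDF_zero (hα1 : ∑ i, α i = 1) {m : ℕ} (hm : 1 ≤ m) : approxCDF s T α n m 0 = 0 := by
  rw [approxCDF, NNReal.coe_zero, approxSurvival_zero hα1 hm, sub_self]

lemma piecewiseConst_eq (hs : IsGrid s) (k : Fin K) {u : ℝ} (h1 : s k.castSucc < ENNReal.ofReal u)
    (h2 : ENNReal.ofReal u ≤ s k.succ) : piecewiseConst s T u = T k := by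
  rw [piecewiseConst, Finset.sum_eq_single k, if_pos ⟨h1, h2⟩]
  · rintro k' - hk
    rw [if_neg]
    rintro ⟨h3, h4⟩
    rcases lt_or_gt_of_ne hk with hk | hk
    · have := hs.strictMono.monotone (Fin.succ_le_castSucc_iff.2 hk)
      exact absurd (h1.trans_le (h4.trans this)) (lt_irrefl _)
    · have := hs.strictMono.monotone (Fin.succ_le_castSucc_iff.2 hk)
      exact absurd (h3.trans_le (h2.trans this)) (lt_irrefl _)
  · simp

/-- Every grid interval contains a positive real, at which the matrix function takes the value `T
k`. -/
lemma isSubIntensity_of_piecewiseConst (hs : IsGrid s)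
    (h : ∀ t, 0 < t → IsSubIntensity (piecewiseConst s T t)) (k : Fin K) :
    IsSubIntensity (T k) := by
  obtain ⟨u, h1, h2⟩ := ENNReal.lt_iff_exists_nnreal_btwn.1
    (hs.strictMono (Fin.castSucc_lt_succ (i := k)))
  have hu : 0 < u := by
    have := (zero_le (a := s k.castSucc)).trans_lt h1
    exact_mod_cast this
  rw [← piecewiseConst_eq (T := T) hs k (u := u) (by simpa using h1) (by simpa using h2.le)]
  exact h u hu

end

section

variable {Ω : Type*} [MeasurableSpace Ω] {P : Measure Ω} [IsProbabilityMeasure P]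

omit [IsProbabilityMeasure P] in
lemma HasIPH.exists_isForwardSolution {ι : Type*} [Fintype ι] [DecidableEq ι] {τ : Ω → ℝ≥0}
    {α : ι → ℝ} {T : ℝ → Matrix ι ι ℝ} (hτ : HasIPH P τ α T) {C : ℝ} (hC : 0 ≤ C)
    (hT : ∀ u i j, |T u i j| ≤ C) :
    ∃ v, IsForwardSolution T α v ∧ ∀ t : ℝ≥0, P.real {ω | τ ω ≤ t} = 1 - ∑ i, v t i := by
  obtain ⟨Ω', _, P', _, X, hX, hmap⟩ := hτ.law
  obtain ⟨v, hv, hmeas, hlaw⟩ := hX.absorptionTime_law hC hT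
  refine ⟨v, hv, fun t => ?_⟩
  rw [← hlaw t]
  have h := congrArg (fun μ : Measure ℝ≥0∞ => μ.real (Set.Iic (t : ℝ≥0∞))) hmap
  rw [map_measureReal_apply hτ.measurable.coe_nnreal_ennreal measurableSet_Iic,
    map_measureReal_apply hmeas measurableSet_Iic] at h
  refine Eq.trans ?_ h
  congr 1
  ext ω
  simp

lemma tendsto_real_le_atTop {τ : Ω → ℝ≥0} (hτ : Measurable τ) :
    Tendsto (fun t : ℝ≥0 => P.real {ω | τ ω ≤ t}) atTop (𝓝 1) := by
  have hm : Measurable fun ω => (τ ω : ℝ) := hτ.coe_nnreal_real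
  have := Measure.isProbabilityMeasure_map (μ := P) hm.aemeasurable
  refine ((tendsto_cdf_atTop (P.map fun ω => (τ ω : ℝ))).comp
    (NNReal.tendsto_coe_atTop.2 tendsto_id)).congr fun t => ?_
  rw [Function.comp, cdf_eq_real, map_measureReal_apply hm measurableSet_Iic]
  rfl

end

theorem mainTheorem4 {Ω : Type*} [MeasurableSpace Ω] (P : Measure Ω) [IsProbabilityMeasure P]
    {K p : ℕ} (s : Fin (K + 1) → ℝ≥0∞) (hs : IsGrid s)
    (T : Fin K → Matrix (Fin p) (Fin p) ℝ) (α : Fin p → ℝ)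
    (τ : Ω → ℝ≥0) (hτ : HasIPH P τ α (piecewiseConst s T)) :
    (∀ n m : ℕ, 1 ≤ n → 1 ≤ m → (∀ k i, |T k i i| ≤ n) →
      IsSubIntensity (approxIntensity s T n m)) ∧
    ∃ σ : ℕ → ℕ → Ω → ℝ≥0,
      (∀ n m : ℕ, 1 ≤ n → 1 ≤ m → IsSubIntensity (approxIntensity s T n m) →
        HasPH P (σ n m) (approxInit α m) (approxIntensity s T n m) ∧
        HasDensityOnNonneg P (σ n m) (approxDensity s T α n m)) ∧
      ∀ ε : ℝ, 0 < ε → ∃ q : ℕ → ℝ,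
        (∀ n : ℕ, 1 ≤ n → (∀ m : ℕ, 1 ≤ m → IsSubIntensity (approxIntensity s T n m)) →
          Tendsto (fun m => P.real {ω | ε < |(τ ω : ℝ) - (σ n m ω : ℝ)|}) atTop (𝓝 (q n))) ∧
        Tendsto q atTop (𝓝 0) := by
  have hα := hτ.init_nonneg
  have hα1 := hτ.init_sum
  have hτm := hτ.measurable
  have hT := isSubIntensity_of_piecewiseConst hs hτ.subIntensity
  have hsub : ∀ n m : ℕ, 1 ≤ n → 1 ≤ m → (∀ k i, |T k i i| ≤ n) →
      IsSubIntensity (approxIntensity s T n m) := fun n m hn _ hd =>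
    isSubIntensity_approxIntensity hs hT hn hd m
  refine ⟨hsub, ?_⟩
  obtain ⟨C, hC, hTC⟩ : ∃ C : ℝ, 0 ≤ C ∧ ∀ k i j, |T k i j| ≤ C := by
    obtain ⟨C, hC⟩ := Finite.exists_le fun x : Fin K × Fin p × Fin p => |T x.1 x.2.1 x.2.2|
    exact ⟨max C 0, le_max_right _ _, fun k i j => (hC (k, i, j)).trans (le_max_left _ _)⟩
  obtain ⟨v, hv, hlaw⟩ := hτ.exists_isForwardSolution (C := K * C) (by positivity)
    (abs_piecewiseConst_le hTC)
  set F : ℝ≥0 → ℝ := fun t => 1 - ∑ i, v t i with hFdef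
  have hF0 : F 0 = 0 := by
    have : ∀ i, v 0 i = α i := fun i => by simpa using (hv 0 le_rfl i).2
    simp [hFdef, this, hα1]
  have hFlim : Tendsto F atTop (𝓝 1) := (tendsto_real_le_atTop hτm).congr hlaw
  have hFc : Continuous F := by
    refine continuous_const.sub (continuous_finsetSum _ fun i _ => ?_)
    have hci : ContinuousOn (fun t => v t i) (Set.Ici 0) := fun t ht => by
      have h0 : (0 : ℝ) ≤ t := ht
      refine (hv.continuousOn (b := t + 1) (by linarith) i t
        ⟨h0, by linarith⟩).mono_of_mem_nhdsWithin ?_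
      filter_upwards [self_mem_nhdsWithin,
        nhdsWithin_le_nhds (Iio_mem_nhds (show t < t + 1 by linarith))] with u hu hu'
      exact ⟨hu, le_of_lt hu'⟩
    exact hci.comp_continuous NNReal.continuous_coe fun t => t.coe_nonneg
  -- The coupling uses only `τ`, so it needs no extra randomness on the given probability space.
  refine ⟨fun n m ω => quantile (approxCDF s T α n m) (F (τ ω)), ?_, ?_⟩
  · intro n m hn hm h
    have hσm := measurable_quantile_comp (continuous_approxCDF (s := s) (T := T) (α := α) m)
      (monotone_approxCDF hα h hn hm) (tendsto_approxCDF hn m) (hFc.measurable.comp hτm)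
    have hσ := real_quantile_le hτm hlaw hFc hF0 hFlim
      (continuous_approxCDF (s := s) (T := T) (α := α) m)
      (monotone_approxCDF hα h hn hm) (tendsto_approxCDF hn m) (approxCDF_zero hα1 hm).ge
    refine ⟨⟨approxInit_nonneg hα m, sum_approxInit hα1 hm, fun _ _ => h, hσm, ?_⟩, ?_⟩
    · obtain ⟨Ω', _, P', _, X, hX, hXm, hXlaw⟩ := exists_absorptionTime_approx hα hα1 h hn hm
      exact ⟨Ω', _, P', inferInstance, X, hX,
        map_coe_eq_map_of_real_le hσm hXm fun t => (hσ t).trans (hXlaw t).symm⟩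
    · exact hasDensityOnNonneg_of_real_le hσm hσ (approxSurvival_zero hα1 hm)
        (hasDerivAt_approxSurvival hm) (continuous_approxDensity m)
        fun t ht => approxDensity_nonneg hα h hn hm ht
  intro ε hε
  -- Stating existence of the limit conditionally lets `q` be chosen for all `n`, with irrelevant
  -- values at inadmissible ones.
  have hlimit : ∀ n : ℕ, ∃ l : ℝ, 1 ≤ n →
      (∀ m : ℕ, 1 ≤ m → IsSubIntensity (approxIntensity s T n m)) →
      Tendsto (fun m => P.real {ω | ε < |(τ ω : ℝ) -
        (quantile (approxCDF s T α n m) (F (τ ω)) : ℝ)|}) atTop (𝓝 l) := by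
    intro n
    by_cases hn : 1 ≤ n ∧ ∀ m : ℕ, 1 ≤ m → IsSubIntensity (approxIntensity s T n m)
    · obtain ⟨hn, h⟩ := hn
      have hmono := fun m : ℕ => monotone_approxCDF hα (h (m + 1) (Nat.le_add_left 1 m)) hn
        (Nat.le_add_left 1 m)
      have hσmono : ∀ ω, Monotone fun m =>
          quantile (approxCDF s T α n (m + 1)) (F (τ ω)) := fun ω m m' hmm => by
        rcases lt_or_ge (F (τ ω)) 1 with hU | hU
        · rw [quantile_le_iff (continuous_approxCDF _) (hmono m) (tendsto_approxCDF hn _) hU]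
          refine ((quantile_le_iff (continuous_approxCDF _) (hmono m') (tendsto_approxCDF hn _) hU
            _).1 le_rfl).trans ?_
          exact sub_le_sub_left (approxSurvival_mono hα hn h (NNReal.coe_nonneg _)
            (Nat.add_le_add_right hmm 1)) _
        · simp [quantile, not_lt.2 hU]
      obtain ⟨l, hl⟩ := exists_tendsto_real_dist_lt (P := P) hτm
        (fun m => measurable_quantile_comp (continuous_approxCDF _) (hmono m)
          (tendsto_approxCDF hn _) (hFc.measurable.comp hτm)) hσmono hε
      exact ⟨l, fun _ _ => (tendsto_add_atTop_iff_nat 1).1 hl⟩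
    · exact ⟨0, fun h1 h2 => absurd ⟨h1, h2⟩ hn⟩
  choose q hq using hlimit
  refine ⟨q, hq, ?_⟩
  lift ε to ℝ≥0 using hε.le
  have hε' : 0 < ε := hε
  have hgood : ∀ᶠ n : ℕ in atTop, 1 ≤ n ∧
      ∀ m : ℕ, 1 ≤ m → IsSubIntensity (approxIntensity s T n m) := by
    filter_upwards [eventually_ge_atTop 1, eventually_ge_atTop ⌈C⌉₊] with n hn hnC
    exact ⟨hn, fun m hm => hsub n m hn hm fun k i => (hTC k i i).trans (Nat.ceil_le.1 hnC)⟩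
  choose A B hA hB hAB using fun j : ℕ => exists_tendsto_abs_approxSurvival_sub_le hs hα hα1 hv
    (b := ((j * ε : ℝ≥0) : ℝ)) (NNReal.coe_nonneg _)
  -- Letting `m → ∞` in the grid bound removes the truncation errors `B`, for each fixed `J` and
  -- `n`.
  have hbound : ∀ (J n : ℕ), 1 ≤ n →
      (∀ m : ℕ, 1 ≤ m → IsSubIntensity (approxIntensity s T n m)) →
      q n ≤ (1 - F (J * ε)) + ∑ j ∈ Finset.range (J + 1), A j n := by
    intro J n hn h
    have h1 := (tendsto_add_atTop_iff_nat 1).2 (hq n hn h)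
    have h2 : Tendsto (fun m => (1 - F (J * ε)) + ∑ j ∈ Finset.range (J + 1), (A j n + B j n m))
        atTop (𝓝 ((1 - F (J * ε)) + ∑ j ∈ Finset.range (J + 1), (A j n + 0))) :=
      (tendsto_finsetSum _ fun j _ => (hB j n).const_add _).const_add _
    simp only [add_zero] at h2
    refine le_of_tendsto_of_tendsto' h1 h2 fun m => ?_
    have hm : 1 ≤ m + 1 := Nat.le_add_left 1 m
    refine (real_quantile_dist_lt_le hτm hlaw hFc hF0 hFlim (continuous_approxCDF _)
      (monotone_approxCDF hα (h (m + 1) hm) hn hm) (tendsto_approxCDF hn _)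
      (approxCDF_zero hα1 hm).ge hε' J).trans ?_
    refine add_le_add_right (Finset.sum_le_sum fun j _ => ?_) _
    refine le_trans (le_of_eq ?_) (hAB j n hn h m)
    rw [approxCDF, abs_sub_comm]
    congr 1
    ring
  have hJ : Tendsto (fun J : ℕ => 1 - F (J * ε)) atTop (𝓝 0) := by
    have : Tendsto (fun J : ℕ => (J : ℝ≥0) * ε) atTop atTop :=
      tendsto_natCast_atTop_atTop.atTop_mul_const hε'
    simpa using (hFlim.comp this).const_sub 1
  refine tendsto_order.2 ⟨fun a ha => ?_, fun a ha => ?_⟩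
  · filter_upwards [hgood] with n hn
    exact ha.trans_le (ge_of_tendsto' (hq n hn.1 hn.2) fun m => measureReal_nonneg)
  -- First `J` is fixed to make the tail of `τ` small, and then `n → ∞` eliminates the finitely many
  -- Erlang errors.
  · obtain ⟨J, hJa⟩ := (hJ.eventually (gt_mem_nhds ha)).exists
    have hlim : Tendsto (fun n => (1 - F (J * ε)) + ∑ j ∈ Finset.range (J + 1), A j n) atTop
        (𝓝 ((1 - F (J * ε)) + ∑ j ∈ Finset.range (J + 1), (0 : ℝ))) :=
      (tendsto_finsetSum _ fun j _ => hA j).const_add _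
    rw [Finset.sum_const_zero, add_zero] at hlim
    filter_upwards [hgood, hlim.eventually (gt_mem_nhds hJa)] with n hn hna
    exact (hbound J n hn.1 hn.2).trans_lt hna
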